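/- Let $c,D,r,\eta_\infty>0$, $e(\eta)=\frac{\eta_\infty}{\eta_\infty-\eta}$, $\nu=\frac{c^2\eta_\infty}{2D}+1$ and $z_l=\frac{c\sqrt{l(l+1)}}{r}$. Points of the unit sphere $\mathbb S^2$ have spherical coordinates $(\theta,\varphi)\in[0,\pi]\times[0,2\pi)$, with surface measure $\sin\theta\,d\theta\,d\varphi$; $Y_{lm}$ ($l\ge 0$, $-l\le m\le l$) are the orthonormal complex spherical harmonics and $J_\nu$, $Y_\nu$ the Bessel functions of the first and second kind. Put $F_0\equiv 1$ and, for $l\ge1$, $$F_l(\eta)=\frac{\pi z_l(\eta_\infty-\eta)^\nu}{2\eta_\infty^{\nu-1}}\Big(Y_{\nu-1}(z_l\eta_\infty)J_\nu\big(z_l(\eta_\infty-\eta)\big)-J_{\nu-1}(z_l\eta_\infty)Y_\nu\big(z_l(\eta_\infty-\eta)\big)\Big),\qquad \eta\in[0,\eta_\infty).$$ Then there is a constant $C>0$, depending only on $c,D,r,\eta_\infty$, such that the following holds. Let $T$ be a centered isotropic Gaussian random field on $\mathbb S^2$, defined on a probability space $(\Omega,\mathfrak F,P)$ and belonging to $L^2(\Omega\times\mathbb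 S^2)$, with coefficients $a_{lm}=\int_{\mathbb S^2}T\,Y_{lm}^*$ and angular power spectrum $C_l=E|a_{lm}|^2$ (which does not depend on $m$, so that also $C_l=\frac1{2l+1}\sum_{m=-l}^lE|a_{lm}|^2$), and assume $\sum_{l\ge0}C_l(2l+1)<\infty$. Let $u(\eta,\theta,\varphi)$, $\eta\in[0,\eta_\infty)$, be the solution of the initial value problem $$\Big(\frac{e(\eta)}{D}+\frac{e'(\eta)}{c^2e(\eta)}\Big)\frac{\partial u}{\partial\eta}+\frac1{c^2}\frac{\partial^2u}{\partial\eta^2}-\frac1{r^2}\Delta_{\mathbb S^2}u=0,\qquad u\big|_{\eta=0}=T,\qquad \frac{\partial u}{\partial\eta}\Big|_{\eta=0}=0,$$ where $\Delta_{\mathbb S^2}=\frac{\partial^2}{\partial\theta^2}+\cot\theta\frac{\partial}{\partial\theta}+\frac1{\sin^2\theta}\frac{\partial^2}{\partial\varphi^2}$. Here a solution is meant in the weak sense: $u$ is a random field, jointly measurable in the sample point and the point of the sphere for each $\eta$, almost surely $u(\eta,\cdot)\in L^2(\mathbb S^2)$ for all $\eta\in[0,\eta_\infty)$, and for every smooth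 $\psi:\mathbb S^2\to\mathbb R$, almost surely, $U(\eta)=\int_{\mathbb S^2}u(\eta,\cdot)\psi$ is $C^2$ on $[0,\eta_\infty)$ and satisfies $\big(\frac{e}{D}+\frac{e'}{c^2e}\big)U'+\frac1{c^2}U''-\frac1{r^2}\int_{\mathbb S^2}u(\eta,\cdot)\,\Delta_{\mathbb S^2}\psi=0$ on $(0,\eta_\infty)$, $U(0)=\int_{\mathbb S^2}T\psi$, $U'(0)=0$. For $L\in\mathbb N=\{0,1,\dots\}$ let $$u_L(\eta,\theta,\varphi)=\sum_{l=0}^{L}F_l(\eta)\sum_{m=-l}^{l}a_{lm}Y_{lm}(\theta,\varphi).$$ Then for all $L\in\mathbb N$ and all $\eta\in[0,\eta_\infty)$ $$\|u(\eta,\cdot)-u_L(\eta,\cdot)\|_{L^2(\Omega\times\mathbb S^2)}=\Big(E\int_{\mathbb S^2}|u(\eta,\cdot)-u_L(\eta,\cdot)|^2\Big)^{1/2}\le C\Big(\sum_{l=L+1}^\infty C_l(2l+1)\Big)^{1/2};$$ in particular $C$ does not depend on $\eta$. -/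

import Mathlib

open MeasureTheory ProbabilityTheory Filter Topology Set
open scoped ComplexConjugate

noncomputable section

namespace SphDiff

/-! ### Bessel functions -/

/-- Bessel function of the first kind `J_ν(x)`, by its power series
(`1 / Γ` vanishes at the poles of `Γ`, in agreement with the value `Γ = 0` there). -/
def besselJ (ν x : ℝ) : ℝ :=
  (x / 2) ^ ν *
    ∑' k : ℕ, (-(x ^ 2) / 4) ^ k / ((Nat.factorial k : ℝ) * Real.Gamma (ν + (k : ℝ) + 1))

/-- The expression defining the Bessel function of the second kind at noninteger order. -/
def besselYAux (ν x : ℝ) : ℝ :=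
  (besselJ ν x * Real.cos (ν * Real.pi) - besselJ (-ν) x) / Real.sin (ν * Real.pi)

open Classical in
/-- Bessel function of the second kind `Y_ν(x)`; at integer order it is the limit in the order. -/
def besselY (ν x : ℝ) : ℝ :=
  if ∃ n : ℤ, ν = (n : ℝ) then limUnder (𝓝[≠] ν) (fun a : ℝ => besselYAux a x)
  else besselYAux ν x

/-! ### Spherical coordinates, surface measure, spherical harmonics -/

/-- The ambient Euclidean space `ℝ³`. -/
abbrev E3 : Type := EuclideanSpace ℝ (Fin 3)

/-- The unit sphere `𝕊²` in `ℝ³`. -/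
abbrev S2 : Type := Metric.sphere (0 : E3) 1

/-- The point of `ℝ³` with spherical coordinates `(θ, φ)`. -/
def sphVec (θ φ : ℝ) : E3 :=
  !₂[Real.cos θ, Real.sin θ * Real.cos φ, Real.sin θ * Real.sin φ]

theorem sphVec_mem (θ φ : ℝ) : sphVec θ φ ∈ Metric.sphere (0 : E3) 1 := by
  rw [mem_sphere_zero_iff_norm, EuclideanSpace.norm_eq, Real.sqrt_eq_one]
  simp only [sphVec, Fin.sum_univ_three, Real.norm_eq_abs, sq_abs]
  simp
  nlinarith [Real.sin_sq_add_cos_sq θ, Real.sin_sq_add_cos_sq φ]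

/-- The point of the sphere with spherical coordinates `p = (θ, φ)`. -/
def sph (p : ℝ × ℝ) : S2 := ⟨sphVec p.1 p.2, sphVec_mem p.1 p.2⟩

/-- The surface measure `sin θ dθ dφ` on `[0, π] × [0, 2π)`. -/
def sphMeasure : Measure (ℝ × ℝ) :=
  ((volume.restrict (Icc 0 Real.pi)).withDensity (fun θ => ENNReal.ofReal (Real.sin θ))).prod
    (volume.restrict (Ico 0 (2 * Real.pi)))

/-- The Legendre polynomial `P_l`, by the Rodrigues formula. -/
def legendre (l : ℕ) : Polynomial ℝ :=
  Polynomial.C (1 / (2 ^ l * (Nat.factorial l : ℝ))) *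
    (Polynomial.derivative^[l] ((Polynomial.X ^ 2 - 1) ^ l))

/-- `P_l^m(x) = (-1)^m (1 - x²)^{m/2} (d/dx)^m P_l(x)` for `m ≥ 0`. -/
def assocLegendreNat (l m : ℕ) (x : ℝ) : ℝ :=
  (-1) ^ m * (Real.sqrt (1 - x ^ 2)) ^ m * (Polynomial.derivative^[m] (legendre l)).eval x

/-- The associated Legendre function `P_l^m`, `-l ≤ m ≤ l`, extended to negative `m` by the usual
`P_l^{-k} = (-1)^k (l-k)! / (l+k)! P_l^k`. -/
def assocLegendre (l : ℕ) (m : ℤ) (x : ℝ) : ℝ :=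
  if 0 ≤ m then assocLegendreNat l m.toNat x
  else (-1) ^ m.natAbs *
    ((Nat.factorial (l - m.natAbs) : ℝ) / (Nat.factorial (l + m.natAbs) : ℝ)) *
      assocLegendreNat l m.natAbs x

/-- The normalising constant `d_{lm}`. -/
def harmonicConst (l : ℕ) (m : ℤ) : ℝ :=
  (-1) ^ m.natAbs *
    Real.sqrt ((2 * (l : ℝ) + 1) / (4 * Real.pi) *
      ((Nat.factorial ((l : ℤ) - m).toNat : ℝ) / (Nat.factorial ((l : ℤ) + m).toNat : ℝ)))

/-- The spherical harmonic `Y_{lm}(θ, φ)` with `p = (θ, φ)`, for `-l ≤ m ≤ l`. -/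
def sphHarmonic (l : ℕ) (m : ℤ) (p : ℝ × ℝ) : ℂ :=
  (harmonicConst l m : ℂ) * Complex.exp (Complex.I * (m : ℂ) * (p.2 : ℂ)) *
    (assocLegendre l m (Real.cos p.1) : ℂ)

/-- The Laplace–Beltrami operator of the unit sphere in spherical coordinates,
`∂²/∂θ² + cot θ ∂/∂θ + (1 / sin² θ) ∂²/∂φ²`. -/
def laplaceBeltrami (ψ : ℝ × ℝ → ℝ) (p : ℝ × ℝ) : ℝ :=
  iteratedDeriv 2 (fun θ => ψ (θ, p.2)) p.1
    + Real.cos p.1 / Real.sin p.1 * deriv (fun θ => ψ (θ, p.2)) p.1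
    + 1 / Real.sin p.1 ^ 2 * iteratedDeriv 2 (fun φ => ψ (p.1, φ)) p.2

/-! ### Random fields on the sphere -/

section Fields

variable {Ω : Type*} [MeasurableSpace Ω]

/-- The rotation `A` acting on a point of the sphere. -/
def rotate (A : E3 ≃ₗᵢ[ℝ] E3) (x : S2) : S2 :=
  ⟨A x, by simp⟩

/-- Isotropy: the finite-dimensional distributions are invariant under rotations. -/
def IsIsotropic (P : Measure Ω) (T : S2 → Ω → ℝ) : Prop :=
  ∀ A : E3 ≃ₗᵢ[ℝ] E3, LinearMap.det (A.toLinearEquiv : E3 →ₗ[ℝ] E3) = 1 →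
    ∀ (k : ℕ) (x : Fin k → S2) (a : Fin k → ℝ),
      P {ω | ∀ i, T (x i) ω < a i} = P {ω | ∀ i, T (rotate A (x i)) ω < a i}

/-- A centered isotropic Gaussian random field on the sphere belonging to `L²(Ω × 𝕊²)`. -/
structure IsIsotropicGaussianField (P : Measure Ω) (T : S2 → Ω → ℝ) : Prop where
  memLp : MemLp (fun q : Ω × (ℝ × ℝ) => T (sph q.2) q.1) 2 (P.prod sphMeasure)
  gaussian : IsGaussianProcess T P
  centered : ∀ x, ∫ ω, T x ω ∂P = 0
  isotropic : IsIsotropic P T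

/-- The Fourier–Laplace coefficient `a_{lm} = ∫ T Y_{lm}^* sin θ dθ dφ`. -/
def coeff (T : S2 → Ω → ℝ) (l : ℕ) (m : ℤ) (ω : Ω) : ℂ :=
  ∫ p, (T (sph p) ω : ℂ) * conj (sphHarmonic l m p) ∂sphMeasure

/-- The angular power spectrum `C_l`, as the mean of `E |a_{lm}|²` over `-l ≤ m ≤ l`. For an
isotropic field all these second moments coincide. -/
def angularPower (P : Measure Ω) (T : S2 → Ω → ℝ) (l : ℕ) : ℝ :=
  (∑ m ∈ Finset.Icc (-(l : ℤ)) (l : ℤ), ∫ ω, ‖coeff T l m ω‖ ^ 2 ∂P) / (2 * (l : ℝ) + 1)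

/-- If `E |a_{lm}|² = s` for all `m`, then `C_l = s`. -/
theorem angularPower_eq (P : Measure Ω) (T : S2 → Ω → ℝ) (l : ℕ) (s : ℝ)
    (h : ∀ m ∈ Finset.Icc (-(l : ℤ)) (l : ℤ), ∫ ω, ‖coeff T l m ω‖ ^ 2 ∂P = s) :
    angularPower P T l = s := by
  have hc : (Finset.Icc (-(l : ℤ)) (l : ℤ)).card = 2 * l + 1 := by
    rw [Int.card_Icc]; omega
  have hl : (2 * (l : ℝ) + 1) ≠ 0 := by positivity
  rw [angularPower, Finset.sum_congr rfl h, Finset.sum_const, hc, nsmul_eq_mul]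
  push_cast
  field_simp

/-! ### The diffusion equation in expanding space-time -/

/-- The expansion factor `e(η) = η∞ / (η∞ - η)` in conformal time. -/
def expansion (ηinf η : ℝ) : ℝ := ηinf / (ηinf - η)

/-- Weak solutions of the initial value problem
`(e/D + e'/(c² e)) ∂u/∂η + (1/c²) ∂²u/∂η² - (1/r²) Δ u = 0`, `u(0) = T`, `∂u/∂η(0) = 0`, on
`[0, η∞) × 𝕊²`, where `Δ` is the Laplace–Beltrami operator of the unit sphere: the equation is
tested against the smooth functions on the sphere (the restrictions to the sphere of smooth
functions `g` on `ℝ³`), almost surely. -/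
structure IsSolution (c D r ηinf : ℝ) (P : Measure Ω) (T : S2 → Ω → ℝ)
    (u : ℝ → S2 → Ω → ℝ) : Prop where
  measurable : ∀ η ∈ Ico 0 ηinf,
    AEStronglyMeasurable (fun q : Ω × (ℝ × ℝ) => u η (sph q.2) q.1) (P.prod sphMeasure)
  memLp : ∀ᵐ ω ∂P, ∀ η ∈ Ico 0 ηinf, MemLp (fun p => u η (sph p) ω) 2 sphMeasure
  equation : ∀ g : E3 → ℝ, ContDiff ℝ ((⊤ : ℕ∞) : WithTop ℕ∞) g → ∀ᵐ ω ∂P,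
    let ψ : ℝ × ℝ → ℝ := fun p => g (sph p)
    let U : ℝ → ℝ := fun η => ∫ p, u η (sph p) ω * ψ p ∂sphMeasure
    ContDiffOn ℝ 2 U (Ico 0 ηinf) ∧
    (∀ η ∈ Ioo 0 ηinf,
      (expansion ηinf η / D
          + deriv (expansion ηinf) η / (c ^ 2 * expansion ηinf η)) * deriv U η
        + 1 / c ^ 2 * iteratedDeriv 2 U η
        - 1 / r ^ 2 * ∫ p, u η (sph p) ω * laplaceBeltrami ψ p ∂sphMeasure = 0) ∧
    U 0 = ∫ p, T (sph p) ω * ψ p ∂sphMeasure ∧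
    derivWithin U (Ico 0 ηinf) 0 = 0

/-- `z_l = c √(l (l + 1)) / r`. -/
def zFreq (c r : ℝ) (l : ℕ) : ℝ := c * Real.sqrt ((l : ℝ) * ((l : ℝ) + 1)) / r

/-- `ν = c² η∞ / (2 D) + 1`. -/
def order (c D ηinf : ℝ) : ℝ := c ^ 2 * ηinf / (2 * D) + 1

/-- The constants `K₁^{(l)}`. -/
def K1 (c D r ηinf : ℝ) (l : ℕ) : ℝ :=
  Real.pi * zFreq c r l * besselY (order c D ηinf - 1) (zFreq c r l * ηinf)
    / (2 * ηinf ^ (order c D ηinf - 1))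

/-- The constants `K₂^{(l)}`. -/
def K2 (c D r ηinf : ℝ) (l : ℕ) : ℝ :=
  -(Real.pi * zFreq c r l * besselJ (order c D ηinf - 1) (zFreq c r l * ηinf)
    / (2 * ηinf ^ (order c D ηinf - 1)))

/-- The time factors `F_l(η)`. -/
def timeFactor (c D r ηinf : ℝ) (l : ℕ) (η : ℝ) : ℝ :=
  if l = 0 then 1
  else (ηinf - η) ^ order c D ηinf *
    (K1 c D r ηinf l * besselJ (order c D ηinf) (zFreq c r l * (ηinf - η))
      + K2 c D r ηinf l * besselY (order c D ηinf) (zFreq c r l * (ηinf - η)))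

/-- The truncated series `u_L(η, θ, φ) = ∑_{l ≤ L} F_l(η) ∑_{|m| ≤ l} a_{lm} Y_{lm}(θ, φ)`. -/
def truncation (c D r ηinf : ℝ) (T : S2 → Ω → ℝ) (L : ℕ) (η : ℝ) (p : ℝ × ℝ) (ω : Ω) : ℂ :=
  ∑ l ∈ Finset.range (L + 1), (timeFactor c D r ηinf l η : ℂ) *
    ∑ m ∈ Finset.Icc (-(l : ℤ)) (l : ℤ), coeff T l m ω * sphHarmonic l m p

end Fields

end SphDiff

end

open SphDiff

noncomputable section

namespace SphDiff

/-! ### Bessel functions through the entire function `∑ (-t)^k / (k! Γ(a + k + 1))` -/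

section BesselSeries

open Complex

/-- The function `E(a, t) = ∑ (-t)^k / (k! Γ(a + k + 1))`, entire in both variables, with
`J_a(x) = (x / 2)^a E(a, x² / 4)`. -/
def entireBessel (a t : ℂ) : ℂ :=
  ∑' k : ℕ, (-t) ^ k / (Nat.factorial k : ℂ) * (Gamma (a + k + 1))⁻¹

theorem exists_norm_inv_Gamma_le (M : ℝ) :
    ∃ B : ℝ, ∀ (k : ℕ) (a : ℂ), ‖a‖ ≤ M → ‖(Gamma (a + k + 1))⁻¹‖ ≤ B := by
  set K := ⌈M⌉₊ with hK
  have hcont : ∀ k : ℕ, Continuous fun a : ℂ => ‖(Gamma (a + k + 1))⁻¹‖ := fun k =>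
    ((differentiable_one_div_Gamma.continuous).comp (by fun_prop : Continuous
      fun a : ℂ => a + k + 1)).norm
  have hc : Continuous fun a : ℂ => ∑ k ∈ Finset.range (K + 1), ‖(Gamma (a + k + 1))⁻¹‖ :=
    continuous_finsetSum _ fun k _ => hcont k
  obtain ⟨B, hB⟩ := (isCompact_closedBall (0 : ℂ) M).exists_bound_of_continuousOn hc.continuousOn
  have hsmall : ∀ k ≤ K, ∀ a : ℂ, ‖a‖ ≤ M → ‖(Gamma (a + k + 1))⁻¹‖ ≤ B := by
    intro k hk a ha
    refine le_trans ?_ ((le_abs_self _).trans (hB a (by simpa using ha)))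
    exact Finset.single_le_sum (f := fun k : ℕ => ‖(Gamma (a + k + 1))⁻¹‖)
      (fun _ _ => norm_nonneg _) (Finset.mem_range.2 (Nat.lt_succ_of_le hk))
  refine ⟨B, fun k a ha => ?_⟩
  rcases le_total k K with hk | hk
  · exact hsmall k hk a ha
  · induction k, hk using Nat.le_induction with
    | base => exact hsmall K le_rfl a ha
    | succ k hk ih =>
      refine le_trans ?_ ih
      have h := one_div_Gamma_eq_self_mul_one_div_Gamma_add_one (a + k + 1)
      rw [h, norm_mul]
      have h1 : 1 ≤ ‖a + k + 1‖ := by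
        have h2 : ‖((k : ℂ) + 1)‖ ≤ ‖a + k + 1‖ + ‖a‖ := by
          calc ‖((k : ℂ) + 1)‖ = ‖(a + k + 1) - a‖ := by congr 1; ring
            _ ≤ _ := norm_sub_le _ _
        have h3 : ‖((k : ℂ) + 1)‖ = (k : ℝ) + 1 := by
          have : ((k : ℂ) + 1) = ((k + 1 : ℕ) : ℂ) := by push_cast; ring
          rw [this, Complex.norm_natCast]; push_cast; ring
        have h4 : M ≤ k := (Nat.le_ceil M).trans (by exact_mod_cast hk)
        linarith
      have e : a + ((k + 1 : ℕ) : ℂ) + 1 = a + k + 1 + 1 := by push_cast; ring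
      rw [e]
      exact le_mul_of_one_le_left (norm_nonneg _) h1

theorem exists_norm_entireBessel_term_le (M R : ℝ) :
    ∃ v : ℕ → ℝ, Summable v ∧ ∀ (k : ℕ) (a t : ℂ), ‖a‖ ≤ M → ‖t‖ ≤ R →
      ‖(-t) ^ k / (Nat.factorial k : ℂ) * (Gamma (a + k + 1))⁻¹‖ ≤ v k := by
  obtain ⟨B, hB⟩ := exists_norm_inv_Gamma_le M
  refine ⟨fun k => R ^ k / (Nat.factorial k : ℝ) * B,
    (Real.summable_pow_div_factorial R).mul_right B, fun k a t ha ht => ?_⟩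
  have hB0 : 0 ≤ B := (norm_nonneg _).trans (hB k a ha)
  rw [norm_mul, norm_div, norm_pow, norm_neg, Complex.norm_natCast]
  have h1 : 0 ≤ R := (norm_nonneg t).trans ht
  exact mul_le_mul (by gcongr) (hB k a ha) (norm_nonneg _) (by positivity)

theorem hasSum_entireBessel (a t : ℂ) :
    HasSum (fun k : ℕ => (-t) ^ k / (Nat.factorial k : ℂ) * (Gamma (a + k + 1))⁻¹)
      (entireBessel a t) := by
  obtain ⟨v, hv, h⟩ := exists_norm_entireBessel_term_le ‖a‖ ‖t‖
  exact (Summable.of_norm_bounded hv fun k => h k a t le_rfl le_rfl).hasSum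

theorem differentiable_entireBessel_order (t : ℂ) :
    Differentiable ℂ fun a => entireBessel a t := by
  intro a
  obtain ⟨v, hv, h⟩ := exists_norm_entireBessel_term_le (‖a‖ + 1) ‖t‖
  have hd : DifferentiableOn ℂ (fun a => entireBessel a t) (Metric.ball 0 (‖a‖ + 1)) := by
    refine differentiableOn_tsum_of_summable_norm hv (fun k => ?_) Metric.isOpen_ball
      (fun k w hw => h k w t (by simpa using (Metric.mem_ball.1 hw).le) le_rfl)
    refine Differentiable.differentiableOn ?_
    exact ((differentiable_one_div_Gamma).comp
      (by fun_prop : Differentiable ℂ fun a : ℂ => a + k + 1)).const_mul _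
  exact hd.differentiableAt (Metric.isOpen_ball.mem_nhds (by simp))

theorem hasDerivAt_entireBessel (a t : ℂ) :
    HasDerivAt (entireBessel a) (-entireBessel (a + 1) t) t := by
  obtain ⟨v, hv, h⟩ := exists_norm_entireBessel_term_le ‖a‖ (‖t‖ + 1)
  have hb : ∀ (k : ℕ) (w : ℂ), w ∈ Metric.ball (0 : ℂ) (‖t‖ + 1) →
      ‖(-w) ^ k / (Nat.factorial k : ℂ) * (Gamma (a + k + 1))⁻¹‖ ≤ v k :=
    fun k w hw => h k a w le_rfl (by simpa using (Metric.mem_ball.1 hw).le)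
  have hdk : ∀ k : ℕ, Differentiable ℂ
      fun w : ℂ => (-w) ^ k / (Nat.factorial k : ℂ) * (Gamma (a + k + 1))⁻¹ := by
    intro k; fun_prop
  have ht : t ∈ Metric.ball (0 : ℂ) (‖t‖ + 1) := by simp
  have hd : DifferentiableAt ℂ (entireBessel a) t :=
    (differentiableOn_tsum_of_summable_norm hv (fun k => (hdk k).differentiableOn)
      Metric.isOpen_ball hb).differentiableAt (Metric.isOpen_ball.mem_nhds ht)
  have hs := hasSum_deriv_of_summable_norm hv (fun k => (hdk k).differentiableOn)
      Metric.isOpen_ball hb ht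
  have hs2 := (hasSum_entireBessel (a + 1) t).neg
  have hderiv : ∀ k : ℕ, deriv (fun w : ℂ => (-w) ^ k / (Nat.factorial k : ℂ) *
      (Gamma (a + k + 1))⁻¹) t = -(k * (-t) ^ (k - 1)) / (Nat.factorial k : ℂ) *
      (Gamma (a + k + 1))⁻¹ := by
    intro k
    have := (((hasDerivAt_neg t).pow k).div_const (Nat.factorial k : ℂ)).mul_const
      ((Gamma (a + k + 1))⁻¹)
    refine HasDerivAt.deriv (this.congr_deriv ?_)
    ring
  simp only [hderiv] at hs
  have hs3 := (hasSum_nat_add_iff' 1).2 hs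
  have hfun : (fun k : ℕ => -(((k + 1 : ℕ) : ℂ) * (-t) ^ (k + 1 - 1)) /
      (Nat.factorial (k + 1) : ℂ) * (Gamma (a + (k + 1 : ℕ) + 1))⁻¹) =
      fun k : ℕ => -((-t) ^ k / (Nat.factorial k : ℂ) * (Gamma (a + 1 + k + 1))⁻¹) := by
    funext k
    have h0 : (Nat.factorial k : ℂ) ≠ 0 := by exact_mod_cast Nat.factorial_ne_zero k
    have h1 : ((k : ℂ) + 1) ≠ 0 := by exact_mod_cast Nat.succ_ne_zero k
    have e : a + ((k + 1 : ℕ) : ℂ) + 1 = a + 1 + k + 1 := by push_cast; ring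
    rw [e, Nat.factorial_succ, Nat.add_sub_cancel]
    push_cast
    field_simp
  rw [hfun] at hs3
  have heq := hs3.unique hs2
  simp only [Finset.range_one, Finset.sum_singleton, Nat.cast_zero, zero_mul, neg_zero, zero_div,
    sub_zero] at heq
  rw [← heq]
  exact hd.hasDerivAt

theorem entireBessel_sub_one (a t : ℂ) :
    entireBessel (a - 1) t = a * entireBessel a t - t * entireBessel (a + 1) t := by
  have h1 := hasSum_entireBessel (a - 1) t
  have h2 := (hasSum_entireBessel a t).mul_left a
  have h3 := (hasSum_entireBessel (a + 1) t).mul_left (-t)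
  have h4 := (hasSum_nat_add_iff' 1).2 (h1.sub h2)
  have hfun : (fun k : ℕ => (-t) ^ (k + 1) / (Nat.factorial (k + 1) : ℂ) *
        (Gamma (a - 1 + (k + 1 : ℕ) + 1))⁻¹ -
      a * ((-t) ^ (k + 1) / (Nat.factorial (k + 1) : ℂ) * (Gamma (a + (k + 1 : ℕ) + 1))⁻¹)) =
      fun k : ℕ => -t * ((-t) ^ k / (Nat.factorial k : ℂ) * (Gamma (a + 1 + k + 1))⁻¹) := by
    funext k
    have h0 : (Nat.factorial k : ℂ) ≠ 0 := by exact_mod_cast Nat.factorial_ne_zero k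
    have h1 : ((k : ℂ) + 1) ≠ 0 := by exact_mod_cast Nat.succ_ne_zero k
    have e : a + ((k + 1 : ℕ) : ℂ) + 1 = a + k + 1 + 1 := by push_cast; ring
    have e' : a - 1 + ((k + 1 : ℕ) : ℂ) + 1 = a + k + 1 := by push_cast; ring
    have e'' : a + 1 + (k : ℂ) + 1 = a + k + 1 + 1 := by ring
    rw [e, e', e'', one_div_Gamma_eq_self_mul_one_div_Gamma_add_one (a + k + 1),
      Nat.factorial_succ]
    push_cast
    field_simp
    ring
  rw [hfun] at h4
  have heq := h4.unique h3
  have hz := one_div_Gamma_eq_self_mul_one_div_Gamma_add_one a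
  simp only [Finset.range_one, Finset.sum_singleton, Nat.cast_zero, pow_zero, Nat.factorial_zero,
    Nat.cast_one, div_one, one_mul, add_zero, sub_add_cancel] at heq
  linear_combination heq + hz

theorem entireBessel_zero (a : ℂ) : entireBessel a 0 = (Gamma (a + 1))⁻¹ := by
  rw [entireBessel, tsum_eq_single 0]
  · simp
  · intro k hk; simp [hk]

theorem entireBessel_neg_natCast (n : ℕ) (t : ℂ) :
    entireBessel (-n) t = (-t) ^ n * entireBessel n t := by
  have h := (hasSum_nat_add_iff' n).2 (hasSum_entireBessel (-n) t)
  have h2 := (hasSum_entireBessel n t).mul_left ((-t) ^ n)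
  have hz : ∑ k ∈ Finset.range n, (-t) ^ k / (Nat.factorial k : ℂ) *
      (Gamma (-(n : ℂ) + k + 1))⁻¹ = 0 := by
    refine Finset.sum_eq_zero fun k hk => ?_
    have hk' := Finset.mem_range.1 hk
    have : -(n : ℂ) + k + 1 = -((n - 1 - k : ℕ) : ℂ) := by
      have : n = (n - 1 - k) + k + 1 := by omega
      conv_lhs => rw [this]
      simp only [Nat.cast_add, Nat.cast_one]; ring
    rw [this, Gamma_neg_nat_eq_zero, inv_zero, mul_zero]
  have hfun : (fun k : ℕ => (-t) ^ (k + n) / (Nat.factorial (k + n) : ℂ) *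
      (Gamma (-(n : ℂ) + (k + n : ℕ) + 1))⁻¹) = fun k : ℕ => (-t) ^ n *
      ((-t) ^ k / (Nat.factorial k : ℂ) * (Gamma (n + k + 1))⁻¹) := by
    funext k
    have e1 : -(n : ℂ) + (k + n : ℕ) + 1 = (k : ℂ) + 1 := by push_cast; ring
    have e2 : (n : ℂ) + k + 1 = ((k + n : ℕ) : ℂ) + 1 := by push_cast; ring
    rw [e1, e2, Gamma_nat_eq_factorial, Gamma_nat_eq_factorial]
    ring
  rw [hz, sub_zero, hfun] at h
  exact h.unique h2

/-- The values of `entireBessel` at real arguments. -/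
def besselE (a t : ℝ) : ℝ := (entireBessel a t).re

theorem entireBessel_ofReal (a t : ℝ) : entireBessel a t =
    ((∑' k : ℕ, (-t) ^ k / ((Nat.factorial k : ℝ) * Real.Gamma (a + k + 1)) : ℝ) : ℂ) := by
  rw [entireBessel, Complex.ofReal_tsum]
  refine tsum_congr fun k => ?_
  have : (a : ℂ) + k + 1 = ((a + k + 1 : ℝ) : ℂ) := by push_cast; ring
  rw [this, Complex.Gamma_ofReal]
  push_cast
  rw [div_mul_eq_div_mul_one_div, one_div]

theorem ofReal_besselE (a t : ℝ) : (besselE a t : ℂ) = entireBessel a t := by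
  rw [besselE, entireBessel_ofReal, Complex.ofReal_re]

theorem besselJ_eq (a x : ℝ) : besselJ a x = (x / 2) ^ a * besselE a (x ^ 2 / 4) := by
  rw [besselJ, besselE, entireBessel_ofReal, Complex.ofReal_re, neg_div]

theorem hasDerivAt_besselE (a t : ℝ) : HasDerivAt (besselE a) (-besselE (a + 1) t) t := by
  have h := (hasDerivAt_entireBessel a t).real_of_complex
  refine h.congr_deriv ?_
  rw [besselE, Complex.neg_re]
  push_cast
  rfl

theorem differentiable_besselE_order (t : ℝ) : Differentiable ℝ fun a => besselE a t := by
  intro a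
  exact ((differentiable_entireBessel_order t a).hasDerivAt.real_of_complex).differentiableAt

theorem besselE_sub_one (a t : ℝ) :
    besselE (a - 1) t = a * besselE a t - t * besselE (a + 1) t := by
  have := entireBessel_sub_one a t
  apply Complex.ofReal_injective
  push_cast [ofReal_besselE]
  exact this

theorem besselE_zero (a : ℝ) : besselE a 0 = (Real.Gamma (a + 1))⁻¹ := by
  have := entireBessel_zero a
  apply Complex.ofReal_injective
  rw [ofReal_besselE]
  push_cast
  rw [this, ← Complex.Gamma_ofReal]
  push_cast
  rfl

theorem besselE_neg_natCast (n : ℕ) (t : ℝ) :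
    besselE (-n) t = (-t) ^ n * besselE n t := by
  have := entireBessel_neg_natCast n t
  apply Complex.ofReal_injective
  push_cast [ofReal_besselE]
  exact this

end BesselSeries

/-- The Wronskian relation of `J_a` and `J_{-a}`. -/
theorem besselE_wronskian (a t : ℝ) :
    besselE (a - 1) t * besselE (-a) t + t * (besselE a t * besselE (1 - a) t) =
      Real.sin (Real.pi * a) / Real.pi := by
  set G : ℝ → ℝ := fun t => besselE (a - 1) t * besselE (-a) t +
    t * (besselE a t * besselE (1 - a) t) with hG
  have hd : ∀ t, HasDerivAt G 0 t := by
    intro t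
    have h1 := hasDerivAt_besselE (a - 1) t
    have h2 := hasDerivAt_besselE (-a) t
    have h3 := hasDerivAt_besselE a t
    have h4 := hasDerivAt_besselE (1 - a) t
    refine ((h1.mul h2).add ((hasDerivAt_id t).mul (h3.mul h4))).congr_deriv ?_
    have r1 := besselE_sub_one a t
    have r2 := besselE_sub_one (1 - a) t
    have e1 : a - 1 + 1 = a := by ring
    have e2 : -a + 1 = 1 - a := by ring
    have e3 : 1 - a - 1 = -a := by ring
    rw [e3] at r2
    simp only [e1, e2, id, Pi.mul_apply]
    rw [r1, r2]
    ring
  have hconst : G t = G 0 :=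
    is_const_of_deriv_eq_zero (fun t => (hd t).differentiableAt) (fun t => (hd t).deriv) t 0
  have h0 : G 0 = Real.sin (Real.pi * a) / Real.pi := by
    simp only [hG, zero_mul, add_zero, besselE_zero]
    have e1 : a - 1 + 1 = a := by ring
    have e2 : -a + 1 = 1 - a := by ring
    rw [e1, e2, ← mul_inv, Real.Gamma_mul_Gamma_one_sub, inv_div]
  exact hconst.trans h0

theorem continuous_besselJ_order {x : ℝ} (hx : 0 < x) : Continuous fun a => besselJ a x := by
  simp only [besselJ_eq]
  have := (differentiable_besselE_order (x ^ 2 / 4)).continuous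
  have h2 : x / 2 ≠ 0 := by positivity
  exact (Real.continuous_const_rpow h2).mul this

theorem differentiable_besselJ_order {x : ℝ} (hx : 0 < x) :
    Differentiable ℝ fun a => besselJ a x := by
  simp only [besselJ_eq]
  have h2 : 0 < x / 2 := by positivity
  intro a
  exact (((hasDerivAt_id a).const_rpow h2).differentiableAt).mul
    (differentiable_besselE_order (x ^ 2 / 4) a)

theorem besselJ_neg_natCast (n : ℕ) {x : ℝ} (hx : 0 < x) :
    besselJ (-n) x = (-1) ^ n * besselJ n x := by
  have h2 : x / 2 ≠ 0 := by positivity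
  rw [besselJ_eq, besselJ_eq, besselE_neg_natCast, Real.rpow_neg (by positivity),
    Real.rpow_natCast]
  have : -(x ^ 2 / 4) = (-1) * ((x / 2) * (x / 2)) := by ring
  rw [this, mul_pow, mul_pow]
  field_simp

theorem besselJ_neg_intCast (n : ℤ) {x : ℝ} (hx : 0 < x) :
    besselJ (-n) x = (-1) ^ n * besselJ n x := by
  rcases n.eq_nat_or_neg with ⟨k, rfl | rfl⟩
  · simpa using besselJ_neg_natCast k hx
  · have := besselJ_neg_natCast k hx
    push_cast
    rw [neg_neg, this, zpow_neg, zpow_natCast, ← mul_assoc, inv_mul_cancel₀ (by simp), one_mul]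

theorem sin_mul_pi_eq_zero_iff (a : ℝ) : Real.sin (a * Real.pi) = 0 ↔ ∃ n : ℤ, a = n := by
  rw [Real.sin_eq_zero_iff]
  constructor
  · rintro ⟨n, hn⟩
    exact ⟨n, (mul_right_cancel₀ Real.pi_ne_zero hn).symm⟩
  · rintro ⟨n, rfl⟩; exact ⟨n, rfl⟩

theorem hasDerivAt_sin_mul_pi (a : ℝ) : HasDerivAt (fun a => Real.sin (a * Real.pi))
    (Real.cos (a * Real.pi) * Real.pi) a := by
  simpa using ((hasDerivAt_id a).mul_const Real.pi).sin

theorem eventually_sin_mul_pi_ne_zero (a : ℝ) :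
    ∀ᶠ b in 𝓝[≠] a, Real.sin (b * Real.pi) ≠ 0 := by
  by_cases h : Real.sin (a * Real.pi) = 0
  · have := (hasDerivAt_sin_mul_pi a).eventually_ne (c := 0) ?_
    · exact this
    · have h2 := Real.sin_sq_add_cos_sq (a * Real.pi)
      rw [h] at h2
      refine mul_ne_zero (fun hc => ?_) Real.pi_ne_zero
      rw [hc] at h2; norm_num at h2
  · exact ((hasDerivAt_sin_mul_pi a).continuousAt.eventually_ne h).filter_mono nhdsWithin_le_nhds

/-- The defining expression of `Y_a(x)` converges to `Y_ν(x)` as `a → ν`, for every order `ν`. -/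
theorem tendsto_besselYAux (ν : ℝ) {x : ℝ} (hx : 0 < x) :
    Tendsto (fun a => besselYAux a x) (𝓝[≠] ν) (𝓝 (besselY ν x)) := by
  have hJ := differentiable_besselJ_order hx
  have hcos : Differentiable ℝ fun a : ℝ => Real.cos (a * Real.pi) := by fun_prop
  have hN : Differentiable ℝ fun a =>
      besselJ a x * Real.cos (a * Real.pi) - besselJ (-a) x :=
    (hJ.mul hcos).sub (hJ.comp differentiable_neg)
  by_cases h : ∃ n : ℤ, ν = n
  · have hex : ∃ y, Tendsto (fun a => besselYAux a x) (𝓝[≠] ν) (𝓝 y) := by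
      obtain ⟨n, rfl⟩ := h
      have hs := (sin_mul_pi_eq_zero_iff n).2 ⟨n, rfl⟩
      have h1 := (hN n).hasDerivAt.tendsto_slope
      have h2 := (hasDerivAt_sin_mul_pi n).tendsto_slope
      have hne : Real.cos (n * Real.pi) * Real.pi ≠ 0 := by
        have h2 := Real.sin_sq_add_cos_sq (n * Real.pi)
        rw [hs] at h2
        refine mul_ne_zero (fun hc => ?_) Real.pi_ne_zero
        rw [hc] at h2; norm_num at h2
      refine ⟨_, (h1.div h2 hne).congr' ?_⟩
      filter_upwards [self_mem_nhdsWithin] with a ha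
      have ha' : a - n ≠ 0 := sub_ne_zero.2 ha
      have hz : besselJ n x * Real.cos (n * Real.pi) - besselJ (-n) x = 0 := by
        rw [besselJ_neg_intCast n hx, Real.cos_int_mul_pi]; ring
      simp only [Pi.div_apply, slope_def_field, hz, hs, sub_zero, besselYAux]
      rw [div_div_div_cancel_right₀ ha']
    rw [besselY, if_pos h]
    exact tendsto_nhds_limUnder hex
  · rw [besselY, if_neg h]
    have hs : Real.sin (ν * Real.pi) ≠ 0 := fun h' => h ((sin_mul_pi_eq_zero_iff ν).1 h')
    exact ((hN ν).continuousAt.div (hasDerivAt_sin_mul_pi ν).continuousAt hs).tendsto.mono_left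
      nhdsWithin_le_nhds

/-- The solution, in the variable `s`, of `w'' - (2a - 1) / s w' + z² w = 0` with `w(h) = 1` and
`w'(h) = 0`, for a noninteger order `a`. -/
def besselSol (a z h s : ℝ) : ℝ :=
  Real.pi / Real.sin (a * Real.pi) *
    (z ^ 2 / 4 * h ^ (2 - 2 * a) * besselE (1 - a) (z ^ 2 * h ^ 2 / 4) *
        (s ^ (2 * a) * besselE a (z ^ 2 * s ^ 2 / 4)) +
      besselE (a - 1) (z ^ 2 * h ^ 2 / 4) * besselE (-a) (z ^ 2 * s ^ 2 / 4))

/-- The derivative of `besselSol a z h`. -/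
def besselSolDeriv (a z h s : ℝ) : ℝ :=
  Real.pi / Real.sin (a * Real.pi) *
    (z ^ 2 / 4 * h ^ (2 - 2 * a) * besselE (1 - a) (z ^ 2 * h ^ 2 / 4) *
        (2 * s ^ (2 * a - 1) * besselE (a - 1) (z ^ 2 * s ^ 2 / 4)) +
      besselE (a - 1) (z ^ 2 * h ^ 2 / 4) *
        (-(z ^ 2 / 2 * s * besselE (1 - a) (z ^ 2 * s ^ 2 / 4))))

theorem hasDerivAt_besselE_sq (a z s : ℝ) :
    HasDerivAt (fun s => besselE a (z ^ 2 * s ^ 2 / 4))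
      (-(z ^ 2 / 2 * s * besselE (a + 1) (z ^ 2 * s ^ 2 / 4))) s := by
  have h1 : HasDerivAt (fun s : ℝ => z ^ 2 * s ^ 2 / 4) (z ^ 2 / 2 * s) s := by
    refine ((((hasDerivAt_id s).pow 2).const_mul (z ^ 2)).div_const 4).congr_deriv ?_
    simp; ring
  refine ((hasDerivAt_besselE a (z ^ 2 * s ^ 2 / 4)).comp s h1).congr_deriv ?_
  ring

theorem hasDerivAt_rpow_two_mul_besselE (a z : ℝ) {s : ℝ} (hs : 0 < s) :
    HasDerivAt (fun s => s ^ (2 * a) * besselE a (z ^ 2 * s ^ 2 / 4))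
      (2 * s ^ (2 * a - 1) * besselE (a - 1) (z ^ 2 * s ^ 2 / 4)) s := by
  have h1 := Real.hasDerivAt_rpow_const (x := s) (p := 2 * a) (Or.inl hs.ne')
  refine (h1.mul (hasDerivAt_besselE_sq a z s)).congr_deriv ?_
  rw [besselE_sub_one, Real.rpow_sub_one hs.ne']
  field_simp
  ring

theorem hasDerivAt_besselSol (a z h : ℝ) {s : ℝ} (hs : 0 < s) :
    HasDerivAt (besselSol a z h) (besselSolDeriv a z h s) s := by
  have h2 := hasDerivAt_besselE_sq (-a) z s
  rw [show -a + 1 = 1 - a by ring] at h2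
  exact (((hasDerivAt_rpow_two_mul_besselE a z hs).const_mul _).add (h2.const_mul _)).const_mul _

theorem hasDerivAt_besselSolDeriv (a z h : ℝ) {s : ℝ} (hs : 0 < s) :
    HasDerivAt (besselSolDeriv a z h)
      ((2 * a - 1) / s * besselSolDeriv a z h s - z ^ 2 * besselSol a z h s) s := by
  have h1 := (Real.hasDerivAt_rpow_const (x := s) (p := 2 * a - 1) (Or.inl hs.ne')).const_mul 2
  have h2 := hasDerivAt_besselE_sq (a - 1) z s
  have h3 := hasDerivAt_besselE_sq (1 - a) z s
  have h4 : HasDerivAt (fun s : ℝ => z ^ 2 / 2 * s) (z ^ 2 / 2) s := by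
    simpa using (hasDerivAt_id s).const_mul (z ^ 2 / 2)
  refine ((((h1.mul h2).const_mul _).add ((h4.mul h3).neg.const_mul _)).const_mul _).congr_deriv ?_
  have r := besselE_sub_one (1 - a) (z ^ 2 * s ^ 2 / 4)
  rw [show 1 - a - 1 = -a by ring] at r
  rw [besselSolDeriv, besselSol, r, sub_add_cancel, Real.rpow_sub_one hs.ne' (2 * a - 1),
    Real.rpow_sub_one hs.ne' (2 * a)]
  field_simp
  ring

theorem besselSol_self {a : ℝ} (z : ℝ) {h : ℝ} (hh : 0 < h) (ha : Real.sin (a * Real.pi) ≠ 0) :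
    besselSol a z h h = 1 := by
  have hw := besselE_wronskian a (z ^ 2 * h ^ 2 / 4)
  have hp : h ^ (2 - 2 * a) * h ^ (2 * a) = h ^ 2 := by
    rw [← Real.rpow_add hh, sub_add_cancel]; norm_num
  rw [mul_comm Real.pi a] at hw
  have hpi := Real.pi_ne_zero
  have : besselSol a z h h = Real.pi / Real.sin (a * Real.pi) *
      (Real.sin (a * Real.pi) / Real.pi) := by
    rw [← hw, besselSol]
    linear_combination (Real.pi / Real.sin (a * Real.pi)) * (z ^ 2 / 4) *
      besselE (1 - a) (z ^ 2 * h ^ 2 / 4) * besselE a (z ^ 2 * h ^ 2 / 4) * hp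
  rw [this, div_mul_div_cancel₀ ha, div_self hpi]

theorem besselSolDeriv_self (a z : ℝ) {h : ℝ} (hh : 0 < h) : besselSolDeriv a z h h = 0 := by
  have hp : h ^ (2 - 2 * a) * h ^ (2 * a - 1) = h := by
    rw [← Real.rpow_add hh]; norm_num
  rw [besselSolDeriv]
  linear_combination (Real.pi / Real.sin (a * Real.pi)) * (z ^ 2 / 2) *
      besselE (1 - a) (z ^ 2 * h ^ 2 / 4) * besselE (a - 1) (z ^ 2 * h ^ 2 / 4) * hp

/-- The Bessel expression of the time factors, with `besselYAux` for `Y`, is `besselSol`. -/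
theorem besselYAux_expr_eq_besselSol {a z h s : ℝ} (hz : 0 < z) (hh : 0 < h) (hs : 0 < s) :
    s ^ a * (Real.pi * z * besselYAux (a - 1) (z * h) / (2 * h ^ (a - 1)) * besselJ a (z * s) +
      -(Real.pi * z * besselJ (a - 1) (z * h) / (2 * h ^ (a - 1))) * besselYAux a (z * s)) =
    besselSol a z h s := by
  have hsin : Real.sin ((a - 1) * Real.pi) = -Real.sin (a * Real.pi) := by
    rw [sub_mul, one_mul, Real.sin_sub_pi]
  have hcos : Real.cos ((a - 1) * Real.pi) = -Real.cos (a * Real.pi) := by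
    rw [sub_mul, one_mul, Real.cos_sub_pi]
  have hq : 0 < z / 2 := by positivity
  rw [besselYAux, besselYAux, hsin, hcos, besselSol]
  simp only [besselJ_eq]
  rw [show -(a - 1) = 1 - a by ring, show z * s / 2 = z / 2 * s by ring,
    show z * h / 2 = z / 2 * h by ring, show (z * h) ^ 2 = z ^ 2 * h ^ 2 by ring,
    show (z * s) ^ 2 = z ^ 2 * s ^ 2 by ring]
  simp only [Real.mul_rpow hq.le hs.le, Real.mul_rpow hq.le hh.le, Real.rpow_sub hq,
    Real.rpow_sub hh,
    Real.rpow_neg hq.le, Real.rpow_neg hs.le, Real.rpow_one, two_mul, Real.rpow_add hs,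
    Real.rpow_add hh]
  have h2 : h ^ (2 : ℝ) = h ^ 2 := by norm_num
  have e1 := (Real.rpow_pos_of_pos hq a).ne'
  have e2 := (Real.rpow_pos_of_pos hs a).ne'
  have e3 := (Real.rpow_pos_of_pos hh a).ne'
  generalize (z / 2) ^ a = A at *
  generalize s ^ a = B at *
  generalize h ^ a = K at *
  rw [h2]
  field_simp
  ring

theorem tendsto_besselSol_timeFactor {c D r ηinf η : ℝ} {l : ℕ} (hl : l ≠ 0) (hc : 0 < c)
    (hr : 0 < r) (hη : 0 < ηinf) (hlt : η < ηinf) :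
    Tendsto (fun a => besselSol a (zFreq c r l) ηinf (ηinf - η)) (𝓝[≠] (order c D ηinf))
      (𝓝 (timeFactor c D r ηinf l η)) := by
  have hs : 0 < ηinf - η := sub_pos.2 hlt
  have hl' : (0 : ℝ) < l := by exact_mod_cast Nat.pos_of_ne_zero hl
  have hz : 0 < zFreq c r l := by rw [zFreq]; positivity
  set ν := order c D ηinf
  set z := zFreq c r l
  have hid : Tendsto (fun a : ℝ => a) (𝓝[≠] ν) (𝓝 ν) := nhdsWithin_le_nhds
  have hsub : Tendsto (fun a : ℝ => a - 1) (𝓝[≠] ν) (𝓝[≠] (ν - 1)) := by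
    refine tendsto_nhdsWithin_iff.2 ⟨hid.sub_const 1, ?_⟩
    filter_upwards [self_mem_nhdsWithin] with a ha using fun h => ha (sub_left_injective h)
  have hY1 := (tendsto_besselYAux (ν - 1) (mul_pos hz hη)).comp hsub
  have hY := tendsto_besselYAux ν (mul_pos hz hs)
  have hJ := ((continuous_besselJ_order (mul_pos hz hs)).tendsto ν).comp hid
  have hJ1 := ((continuous_besselJ_order (mul_pos hz hη)).tendsto (ν - 1)).comp (hid.sub_const 1)
  have hp := ((Real.continuous_const_rpow hs.ne').tendsto ν).comp hid
  have hp1 := ((Real.continuous_const_rpow hη.ne').tendsto (ν - 1)).comp (hid.sub_const 1)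
  have hne : 2 * ηinf ^ (ν - 1) ≠ 0 := by positivity
  have key := hp.mul (((((hY1.const_mul (Real.pi * z)).div (hp1.const_mul 2) hne).mul hJ).add
    (((hJ1.const_mul (Real.pi * z)).div (hp1.const_mul 2) hne).neg.mul hY)))
  have hval : timeFactor c D r ηinf l η = (ηinf - η) ^ ν *
      (Real.pi * z * besselY (ν - 1) (z * ηinf) / (2 * ηinf ^ (ν - 1)) *
        besselJ ν (z * (ηinf - η)) +
      -(Real.pi * z * besselJ (ν - 1) (z * ηinf) / (2 * ηinf ^ (ν - 1))) *
        besselY ν (z * (ηinf - η))) := by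
    rw [timeFactor, if_neg hl, K1, K2]
  rw [hval]
  exact key.congr fun a => besselYAux_expr_eq_besselSol hz hη hs

/-! ### Energy estimates for damped oscillators -/

theorem energy_le {W V f p : ℝ → ℝ} {z b κ lam : ℝ}
    (hWc : ContinuousOn W (Icc 0 b)) (hVc : ContinuousOn V (Icc 0 b))
    (hW : ∀ t ∈ Ioo 0 b, HasDerivAt W (V t) t)
    (hV : ∀ t ∈ Ioo 0 b, HasDerivAt V (f t - p t * V t - z ^ 2 * W t) t)
    (hp : ∀ t ∈ Ioo 0 b, 0 ≤ p t) (hlam : 0 ≤ lam)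
    (hf : ∀ t ∈ Ioo 0 b, 2 * (V t * f t) ≤ lam * (V t ^ 2 + κ)) {t : ℝ} (ht : t ∈ Icc 0 b) :
    z ^ 2 * W t ^ 2 + V t ^ 2 + κ ≤
      (z ^ 2 * W 0 ^ 2 + V 0 ^ 2 + κ) * Real.exp (lam * t) := by
  set E : ℝ → ℝ := fun t => (z ^ 2 * W t ^ 2 + V t ^ 2 + κ) * Real.exp (-(lam * t)) with hE
  have hd : ∀ t ∈ Ioo 0 b, HasDerivAt E
      ((2 * (V t * f t) - lam * (V t ^ 2 + κ) - 2 * p t * V t ^ 2 - lam * (z ^ 2 * W t ^ 2)) *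
        Real.exp (-(lam * t))) t := by
    intro t ht
    have h1 := (((hW t ht).pow 2).const_mul (z ^ 2)).add ((hV t ht).pow 2)
    have h2 : HasDerivAt (fun t => Real.exp (-(lam * t))) (Real.exp (-(lam * t)) * -lam) t := by
      simpa using (((hasDerivAt_id t).const_mul lam).neg).exp
    refine ((h1.add_const κ).mul h2).congr_deriv ?_
    simp
    ring
  have hanti : AntitoneOn E (Icc 0 b) := by
    refine antitoneOn_of_deriv_nonpos (convex_Icc 0 b) ?_ ?_ ?_
    · exact ((((hWc.pow 2).const_smul (z ^ 2)).add (hVc.pow 2)).add continuousOn_const).mul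
        (by fun_prop)
    · rw [interior_Icc]
      exact fun t ht => (hd t ht).differentiableAt.differentiableWithinAt
    · rw [interior_Icc]
      intro t ht
      rw [(hd t ht).deriv]
      refine mul_nonpos_of_nonpos_of_nonneg ?_ (Real.exp_pos _).le
      have h1 := hf t ht
      have h2 : 0 ≤ 2 * p t * V t ^ 2 := mul_nonneg (mul_nonneg two_pos.le (hp t ht)) (sq_nonneg _)
      have h3 : 0 ≤ lam * (z ^ 2 * W t ^ 2) := by positivity
      linarith
  have h := hanti (left_mem_Icc.2 (ht.1.trans ht.2)) ht ht.1
  simp only [hE, mul_zero, neg_zero, Real.exp_zero, mul_one] at h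
  rw [Real.exp_neg, ← div_eq_mul_inv, div_le_iff₀ (Real.exp_pos _)] at h
  exact h

theorem hasDerivAt_besselSol_comp_sub (a z h : ℝ) {t : ℝ} (ht : t < h) :
    HasDerivAt (fun t => besselSol a z h (h - t)) (-besselSolDeriv a z h (h - t)) t := by
  exact ((hasDerivAt_besselSol a z h (sub_pos.2 ht)).comp t
    ((hasDerivAt_id t).const_sub h)).congr_deriv (by simp)

theorem hasDerivAt_neg_besselSolDeriv_comp_sub (a z h : ℝ) {t : ℝ} (ht : t < h) :
    HasDerivAt (fun t => -besselSolDeriv a z h (h - t))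
      ((2 * a - 1) / (h - t) * besselSolDeriv a z h (h - t) - z ^ 2 * besselSol a z h (h - t))
      t := by
  exact ((hasDerivAt_besselSolDeriv a z h (sub_pos.2 ht)).comp t
    ((hasDerivAt_id t).const_sub h)).neg.congr_deriv (by simp)

theorem abs_besselSol_le_one {a z h η : ℝ} (hz : 0 < z) (hh : 0 < h) (ha : 1 / 2 < a)
    (hsin : Real.sin (a * Real.pi) ≠ 0) (hη : η ∈ Ico 0 h) :
    |besselSol a z h (h - η)| ≤ 1 := by
  have hlt : ∀ t ∈ Icc 0 η, t < h := fun t ht => ht.2.trans_lt hη.2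
  have := energy_le (W := fun t => besselSol a z h (h - t))
    (V := fun t => -besselSolDeriv a z h (h - t)) (f := 0) (p := fun t => (2 * a - 1) / (h - t))
    (z := z) (b := η) (κ := 0) (lam := 0) (t := η)
    (fun t ht => (hasDerivAt_besselSol_comp_sub a z h (hlt t ht)).continuousAt.continuousWithinAt)
    (fun t ht => (hasDerivAt_neg_besselSolDeriv_comp_sub a z h
      (hlt t ht)).continuousAt.continuousWithinAt)
    (fun t ht => hasDerivAt_besselSol_comp_sub a z h (hlt t (Ioo_subset_Icc_self ht)))
    (fun t ht => (hasDerivAt_neg_besselSolDeriv_comp_sub a z h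
      (hlt t (Ioo_subset_Icc_self ht))).congr_deriv (by simp))
    (fun t ht => div_nonneg (by linarith)
      (sub_nonneg.2 (hlt t (Ioo_subset_Icc_self ht)).le)) le_rfl (by simp) ⟨hη.1, le_rfl⟩
  simp only [sub_zero, besselSol_self z hh hsin, besselSolDeriv_self a z hh, zero_mul,
    Real.exp_zero] at this
  rw [← sq_le_one_iff_abs_le_one]
  have hz2 : 0 < z ^ 2 := by positivity
  have h2 : z ^ 2 * besselSol a z h (h - η) ^ 2 ≤ z ^ 2 * 1 := by
    nlinarith [sq_nonneg (besselSolDeriv a z h (h - η))]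
  exact le_of_mul_le_mul_left h2 hz2

/-- The first-order form of a `C²` solution of `U'' + (2ν - 1) / (h - η) U' + z² U = 0`. -/
theorem exists_velocity {U : ℝ → ℝ} {ν z h : ℝ} (hU : ContDiffOn ℝ 2 U (Ico 0 h))
    (hode : ∀ η ∈ Ioo 0 h,
      (2 * ν - 1) / (h - η) * deriv U η + iteratedDeriv 2 U η + z ^ 2 * U η = 0)
    (h0 : derivWithin U (Ico 0 h) 0 = 0) :
    ∃ V : ℝ → ℝ, ContinuousOn V (Ico 0 h) ∧ V 0 = 0 ∧
      (∀ t ∈ Ioo 0 h, HasDerivAt U (V t) t) ∧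
      ∀ t ∈ Ioo 0 h, HasDerivAt V (-((2 * ν - 1) / (h - t) * V t) - z ^ 2 * U t) t := by
  refine ⟨derivWithin U (Ico 0 h), hU.continuousOn_derivWithin (uniqueDiffOn_Ico 0 h) (by norm_num),
    h0, ?_, ?_⟩
  · intro t ht
    have hn : Ico 0 h ∈ 𝓝 t := Ico_mem_nhds ht.1 ht.2
    rw [derivWithin_of_mem_nhds hn]
    exact ((hU.contDiffAt hn).differentiableAt (by norm_num)).hasDerivAt
  · intro t ht
    have hn : Ico 0 h ∈ 𝓝 t := Ico_mem_nhds ht.1 ht.2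
    have hev : derivWithin U (Ico 0 h) =ᶠ[𝓝 t] deriv U := by
      filter_upwards [Ioo_mem_nhds ht.1 ht.2] with s hs
      exact derivWithin_of_mem_nhds (Ico_mem_nhds hs.1 hs.2)
    have hd : DifferentiableAt ℝ (deriv U) t := by
      have h2 : ContDiffOn ℝ 1 (deriv U) (Ioo 0 h) :=
        (hU.mono Ioo_subset_Ico_self).deriv_of_isOpen isOpen_Ioo (by norm_num)
      exact (h2.contDiffAt (Ioo_mem_nhds ht.1 ht.2)).differentiableAt (by norm_num)
    have h2 := hode t ht
    rw [iteratedDeriv_succ, iteratedDeriv_one] at h2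
    rw [hev.eq_of_nhds]
    exact (hd.hasDerivAt.congr_of_eventuallyEq hev).congr_deriv (by linarith)

theorem tendsto_besselSol_of_ode {U : ℝ → ℝ} {ν z h : ℝ} (hz : 0 < z) (hh : 0 < h)
    (hν : 1 / 2 < ν) (hU : ContDiffOn ℝ 2 U (Ico 0 h))
    (hode : ∀ η ∈ Ioo 0 h,
      (2 * ν - 1) / (h - η) * deriv U η + iteratedDeriv 2 U η + z ^ 2 * U η = 0)
    (h0 : derivWithin U (Ico 0 h) 0 = 0) {η : ℝ} (hη : η ∈ Ico 0 h) :
    Tendsto (fun a => U 0 * besselSol a z h (h - η)) (𝓝[≠] ν) (𝓝 (U η)) := by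
  obtain ⟨V, hVc, hV0, hUd, hVd⟩ := exists_velocity hU hode h0
  have hsub : Icc 0 η ⊆ Ico 0 h := fun t ht => ⟨ht.1, ht.2.trans_lt hη.2⟩
  have hsub' : Ioo 0 η ⊆ Ioo 0 h := fun t ht => ⟨ht.1, ht.2.trans hη.2⟩
  obtain ⟨M, hM⟩ := isCompact_Icc.exists_bound_of_continuousOn (hVc.mono hsub)
  have hs : 0 < h - η := sub_pos.2 hη.2
  set B := 2 / (h - η) * M with hB
  have key : ∀ᶠ a in 𝓝[≠] ν, |U 0 * besselSol a z h (h - η) - U η| ≤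
      |a - ν| * (|B| * Real.exp η / z) := by
    filter_upwards [eventually_sin_mul_pi_ne_zero ν,
      nhdsWithin_le_nhds (lt_mem_nhds hν)] with a hsin ha
    have hlt : ∀ t ∈ Icc 0 η, t < h := fun t ht => (hsub ht).2
    have := energy_le (W := fun t => U t - U 0 * besselSol a z h (h - t))
      (V := fun t => V t - U 0 * -besselSolDeriv a z h (h - t))
      (f := fun t => (2 * (a - ν)) / (h - t) * V t) (p := fun t => (2 * a - 1) / (h - t))
      (z := z) (b := η) (κ := ((a - ν) * B) ^ 2) (lam := 1) (t := η)
      ((hU.continuousOn.mono hsub).sub (continuousOn_const.mul fun t ht =>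
        (hasDerivAt_besselSol_comp_sub a z h (hlt t ht)).continuousAt.continuousWithinAt))
      ((hVc.mono hsub).sub (continuousOn_const.mul fun t ht =>
        (hasDerivAt_neg_besselSolDeriv_comp_sub a z h
        (hlt t ht)).continuousAt.continuousWithinAt))
      (fun t ht => (hUd t (hsub' ht)).sub
        ((hasDerivAt_besselSol_comp_sub a z h (hsub' ht).2).const_mul _))
      (fun t ht => ((hVd t (hsub' ht)).sub
        ((hasDerivAt_neg_besselSolDeriv_comp_sub a z h (hsub' ht).2).const_mul _)).congr_deriv
          (by ring))
      (fun t ht => div_nonneg (by linarith) (sub_nonneg.2 (hsub' ht).2.le)) zero_le_one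
      (fun t ht => by
        have h1 : ((2 * (a - ν)) / (h - t) * V t) ^ 2 ≤ ((a - ν) * B) ^ 2 := by
          have hVt := hM t (Ioo_subset_Icc_self ht)
          have h2 : |2 / (h - t) * V t| ≤ B := by
            rw [abs_mul, abs_of_pos (div_pos two_pos (sub_pos.2 (hsub' ht).2))]
            have : h - η ≤ h - t := by linarith [ht.2]
            exact mul_le_mul (by gcongr) hVt (abs_nonneg _) (by positivity)
          calc ((2 * (a - ν)) / (h - t) * V t) ^ 2
              = (a - ν) ^ 2 * (2 / (h - t) * V t) ^ 2 := by ring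
            _ ≤ (a - ν) ^ 2 * B ^ 2 := by
              exact mul_le_mul_of_nonneg_left (sq_le_sq' (abs_le.1 h2).1 (abs_le.1 h2).2)
                (sq_nonneg _)
            _ = _ := by ring
        have := sq_nonneg ((V t - U 0 * -besselSolDeriv a z h (h - t)) -
          (2 * (a - ν)) / (h - t) * V t)
        linarith) ⟨hη.1, le_rfl⟩
    simp only [sub_zero, besselSol_self z hh hsin, besselSolDeriv_self a z hh, hV0, mul_one,
      sub_self, mul_zero, neg_zero] at this
    have h2 : (z * |U 0 * besselSol a z h (h - η) - U η|) ^ 2 ≤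
        (|a - ν| * (|B| * Real.exp η)) ^ 2 := by
      have he : Real.exp (1 * η) ≤ Real.exp η ^ 2 := by
        have : 1 ≤ Real.exp η := Real.one_le_exp hη.1
        rw [one_mul]; nlinarith
      have h3 : ((a - ν) * B) ^ 2 * Real.exp (1 * η) ≤ ((a - ν) * B) ^ 2 * Real.exp η ^ 2 := by
        gcongr
      rw [mul_pow, mul_pow, mul_pow, sq_abs, sq_abs, sq_abs]
      nlinarith [sq_nonneg (V η - U 0 * -besselSolDeriv a z h (h - η)), sq_nonneg ((a - ν) * B)]
    have h4 := abs_le_of_sq_le_sq' h2 (by positivity)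
    rw [← mul_div_assoc, le_div_iff₀ hz, mul_comm]
    exact h4.2
  rw [tendsto_iff_norm_sub_tendsto_zero]
  refine squeeze_zero' (Eventually.of_forall fun _ => norm_nonneg _) key ?_
  have : Tendsto (fun a => |a - ν| * (|B| * Real.exp η / z)) (𝓝 ν)
      (𝓝 (|ν - ν| * (|B| * Real.exp η / z))) := by
    apply Continuous.tendsto; fun_prop
  rw [sub_self, abs_zero, zero_mul] at this
  exact this.mono_left nhdsWithin_le_nhds

theorem one_lt_order {c D ηinf : ℝ} (hc : 0 < c) (hD : 0 < D) (hη : 0 < ηinf) :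
    1 < order c D ηinf := by
  rw [order]; have : 0 < c ^ 2 * ηinf / (2 * D) := by positivity
  linarith

theorem abs_timeFactor_le_one {c D r ηinf η : ℝ} (hc : 0 < c) (hD : 0 < D) (hr : 0 < r)
    (hη : 0 < ηinf) (l : ℕ) (hmem : η ∈ Ico 0 ηinf) : |timeFactor c D r ηinf l η| ≤ 1 := by
  rcases eq_or_ne l 0 with rfl | hl
  · simp [timeFactor]
  have hl' : (0 : ℝ) < l := by exact_mod_cast Nat.pos_of_ne_zero hl
  have hz : 0 < zFreq c r l := by rw [zFreq]; positivity
  refine le_of_tendsto (tendsto_besselSol_timeFactor (D := D) hl hc hr hη hmem.2).abs ?_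
  have h1 := one_lt_order hc hD hη
  filter_upwards [eventually_sin_mul_pi_ne_zero (order c D ηinf),
    nhdsWithin_le_nhds (lt_mem_nhds (show 1 / 2 < order c D ηinf by linarith))] with a hsin ha
  exact abs_besselSol_le_one hz hη ha hsin hmem

/-- The solutions of the radial equation are the multiples of the time factors. -/
theorem eq_mul_timeFactor_of_ode {c D r ηinf : ℝ} (hc : 0 < c) (hD : 0 < D) (hr : 0 < r)
    (hη : 0 < ηinf) (l : ℕ) {U : ℝ → ℝ} (hU : ContDiffOn ℝ 2 U (Ico 0 ηinf))
    (hode : ∀ η ∈ Ioo 0 ηinf, (expansion ηinf η / D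
          + deriv (expansion ηinf) η / (c ^ 2 * expansion ηinf η)) * deriv U η
        + 1 / c ^ 2 * iteratedDeriv 2 U η - 1 / r ^ 2 * (-((l : ℝ) * (l + 1)) * U η) = 0)
    (h0 : derivWithin U (Ico 0 ηinf) 0 = 0) {η : ℝ} (hmem : η ∈ Ico 0 ηinf) :
    U η = U 0 * timeFactor c D r ηinf l η := by
  have hode' : ∀ η ∈ Ioo 0 ηinf, (2 * order c D ηinf - 1) / (ηinf - η) * deriv U η +
      iteratedDeriv 2 U η + zFreq c r l ^ 2 * U η = 0 := by
    intro η hη'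
    have hs : 0 < ηinf - η := sub_pos.2 hη'.2
    have hd : deriv (expansion ηinf) η = ηinf / (ηinf - η) ^ 2 := by
      have := ((hasDerivAt_const η ηinf).div ((hasDerivAt_id η).const_sub ηinf) hs.ne')
      refine (this.congr_deriv ?_).deriv
      simp
    have h := hode η hη'
    rw [hd, expansion] at h
    rw [zFreq, div_pow, mul_pow, Real.sq_sqrt (by positivity), order]
    have h2 : c ^ 2 * ((ηinf / (ηinf - η) / D + ηinf / (ηinf - η) ^ 2 /
      (c ^ 2 * (ηinf / (ηinf - η)))) * deriv U η + 1 / c ^ 2 * iteratedDeriv 2 U η -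
      1 / r ^ 2 * (-((l : ℝ) * (l + 1)) * U η)) = 0 := by rw [h, mul_zero]
    rw [← h2]
    field_simp
    ring
  rcases eq_or_ne l 0 with rfl | hl
  · rw [timeFactor, if_pos rfl, mul_one]
    obtain ⟨V, hVc, hV0, hUd, hVd⟩ := exists_velocity hU hode' h0
    have hz : zFreq c r 0 = 0 := by simp [zFreq]
    have hν := one_lt_order hc hD hη
    have hVz : ∀ t ∈ Ico 0 ηinf, V t = 0 := by
      intro t ht
      have hsub : Icc 0 t ⊆ Ico 0 ηinf := fun s hs => ⟨hs.1, hs.2.trans_lt ht.2⟩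
      have hsub' : Ioo 0 t ⊆ Ioo 0 ηinf := fun s hs => ⟨hs.1, hs.2.trans ht.2⟩
      have := energy_le (W := U) (V := V) (f := 0)
        (p := fun t => (2 * order c D ηinf - 1) / (ηinf - t)) (z := zFreq c r 0) (b := t) (κ := 0)
        (lam := 0) (t := t) (hU.continuousOn.mono hsub) (hVc.mono hsub)
        (fun s hs => hUd s (hsub' hs))
        (fun s hs => (hVd s (hsub' hs)).congr_deriv (by simp))
        (fun s hs => div_nonneg (by linarith) (sub_nonneg.2 (hsub' hs).2.le)) le_rfl (by simp)
        ⟨ht.1, le_rfl⟩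
      rw [hz, hV0] at this
      simp only [ne_eq, OfNat.ofNat_ne_zero, not_false_eq_true, zero_pow, zero_mul, add_zero,
        zero_add] at this
      exact pow_eq_zero_iff (two_ne_zero) |>.1 (le_antisymm this (sq_nonneg _))
    have hsub : Icc 0 η ⊆ Ico 0 ηinf := fun s hs => ⟨hs.1, hs.2.trans_lt hmem.2⟩
    refine constant_of_has_deriv_right_zero (hU.continuousOn.mono hsub) ?_ η ⟨hmem.1, le_rfl⟩
    intro x hx
    have hx' : x ∈ Ico 0 ηinf := hsub (Ico_subset_Icc_self hx)
    rcases hx.1.eq_or_lt with rfl | hpos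
    · have hd := ((hU.differentiableOn (by norm_num)) 0 hx').hasDerivWithinAt
      rw [h0] at hd
      exact (hd.mono_of_mem_nhdsWithin (Ico_mem_nhdsGE hη))
    · have := hUd x ⟨hpos, hx'.2⟩
      rw [hVz x hx'] at this
      exact this.hasDerivWithinAt
  · have hl' : (0 : ℝ) < l := by exact_mod_cast Nat.pos_of_ne_zero hl
    have hz : 0 < zFreq c r l := by rw [zFreq]; positivity
    have h1 := tendsto_besselSol_of_ode hz hη (by linarith [one_lt_order hc hD hη]) hU hode' h0 hmem
    have h2 := (tendsto_besselSol_timeFactor (D := D) hl hc hr hη hmem.2).const_mul (U 0)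
    exact tendsto_nhds_unique h1 h2

/-! ### Derivatives of Legendre polynomials -/

/-- The `k`-th derivative of the Legendre polynomial `P_l`. -/
def legendreDeriv (l k : ℕ) : Polynomial ℝ := Polynomial.derivative^[k] (legendre l)

theorem derivative_legendreDeriv (l k : ℕ) :
    Polynomial.derivative (legendreDeriv l k) = legendreDeriv l (k + 1) := by
  rw [legendreDeriv, legendreDeriv, Function.iterate_succ_apply']

section LegendreODE

open Polynomial

theorem iterate_derivative_rodrigues (l n : ℕ) :
    (X ^ 2 - 1) * derivative^[n + 2] ((X ^ 2 - 1 : ℝ[X]) ^ l) +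
      2 * ((n : ℝ[X]) + 1 - (l : ℝ[X])) * X * derivative^[n + 1] ((X ^ 2 - 1 : ℝ[X]) ^ l) +
      ((n : ℝ[X]) + 1) * ((n : ℝ[X]) - 2 * (l : ℝ[X])) *
        derivative^[n] ((X ^ 2 - 1 : ℝ[X]) ^ l) = 0 := by
  induction n with
  | zero =>
    have h : (X ^ 2 - 1 : ℝ[X]) * derivative ((X ^ 2 - 1 : ℝ[X]) ^ l) =
        2 * (l : ℝ[X]) * X * (X ^ 2 - 1 : ℝ[X]) ^ l := by
      rcases l with _ | l
      · simp
      · rw [derivative_pow]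
        simp
        ring
    have h2 := congrArg derivative h
    simp only [derivative_mul, derivative_sub, derivative_pow, derivative_X, derivative_one,
      derivative_natCast, derivative_ofNat, Nat.cast_ofNat, map_ofNat] at h2
    simp only [Function.iterate_succ_apply', Function.iterate_zero, id, Nat.cast_zero, zero_add,
      derivative_mul, derivative_sub, derivative_pow, derivative_X, derivative_one,
      derivative_ofNat, Nat.cast_ofNat, map_ofNat]
    linear_combination h2
  | succ n ih =>
    have h2 := congrArg derivative ih
    simp only [derivative_mul, derivative_sub, derivative_add, derivative_pow, derivative_X,
      derivative_one, derivative_natCast, derivative_ofNat, ← Function.iterate_succ_apply',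
      derivative_zero, Nat.cast_ofNat, map_ofNat] at h2
    push_cast
    linear_combination h2

theorem legendreDeriv_ode (l k : ℕ) :
    (1 - X ^ 2) * legendreDeriv l (k + 2) - 2 * ((k : ℝ[X]) + 1) * X * legendreDeriv l (k + 1) +
      ((l : ℝ[X]) + (k : ℝ[X]) + 1) * ((l : ℝ[X]) - (k : ℝ[X])) * legendreDeriv l k = 0 := by
  have h := iterate_derivative_rodrigues l (k + l)
  have e : ∀ j, legendreDeriv l j = C (1 / (2 ^ l * (Nat.factorial l : ℝ))) *
      derivative^[j + l] ((X ^ 2 - 1) ^ l) := by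
    intro j
    rw [legendreDeriv, legendre, iterate_derivative_C_mul, ← Function.iterate_add_apply]
  rw [e, e, e, show k + 2 + l = k + l + 2 by ring, show k + 1 + l = k + l + 1 by ring]
  push_cast at h
  linear_combination -(C (1 / (2 ^ l * (Nat.factorial l : ℝ)))) * h

theorem legendreDeriv_ode_eval (l k : ℕ) (x : ℝ) :
    (1 - x ^ 2) * (legendreDeriv l (k + 2)).eval x =
      2 * (k + 1) * x * (legendreDeriv l (k + 1)).eval x -
        ((l : ℝ) + k + 1) * (l - k) * (legendreDeriv l k).eval x := by
  have h := congrArg (eval x) (legendreDeriv_ode l k)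
  simp only [eval_add, eval_sub, eval_mul, eval_pow, eval_X, eval_one, eval_ofNat, eval_natCast,
    eval_zero] at h
  linear_combination h

theorem natDegree_rodrigues (l : ℕ) : ((X ^ 2 - 1 : ℝ[X]) ^ l).natDegree = 2 * l ∧
    ((X ^ 2 - 1 : ℝ[X]) ^ l).Monic := by
  have hm : (X ^ 2 - 1 : ℝ[X]).Monic := by
    simpa using monic_X_pow_sub_C (1 : ℝ) two_ne_zero
  have hd : (X ^ 2 - 1 : ℝ[X]).natDegree = 2 := by
    simpa using natDegree_X_pow_sub_C (n := 2) (r := (1 : ℝ))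
  exact ⟨by rw [hm.natDegree_pow, hd, mul_comm], hm.pow l⟩

theorem legendreDeriv_coeff_top {l k : ℕ} (hk : k ≤ l) : (legendreDeriv l k).coeff (l - k) =
    1 / (2 ^ l * (Nat.factorial l : ℝ)) * ((2 * l).descFactorial (k + l) : ℝ) := by
  rw [legendreDeriv, legendre, iterate_derivative_C_mul, ← Function.iterate_add_apply, coeff_C_mul,
    coeff_iterate_derivative]
  have e : l - k + (k + l) = 2 * l := by omega
  obtain ⟨h1, h2⟩ := natDegree_rodrigues l
  have h3 := h2.coeff_natDegree
  rw [h1] at h3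
  rw [e, h3, nsmul_eq_mul, mul_one]

theorem natDegree_legendreDeriv_le (l k : ℕ) : (legendreDeriv l k).natDegree ≤ l - k := by
  rw [legendreDeriv, legendre, iterate_derivative_C_mul, ← Function.iterate_add_apply]
  refine (natDegree_C_mul_le _ _).trans ((natDegree_iterate_derivative _ _).trans ?_)
  rw [(natDegree_rodrigues l).1]
  omega

theorem degree_legendreDeriv {l k : ℕ} (hk : k ≤ l) :
    (legendreDeriv l k).degree = ((l - k : ℕ) : WithBot ℕ) := by
  refine le_antisymm ((natDegree_le_iff_degree_le).1 (natDegree_legendreDeriv_le l k))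
    (le_degree_of_ne_zero ?_)
  rw [legendreDeriv_coeff_top hk]
  have : 0 < (2 * l).descFactorial (k + l) := Nat.descFactorial_pos.2 (by omega)
  positivity

theorem legendreDeriv_self (l : ℕ) : legendreDeriv l l =
    C (((2 * l).factorial : ℝ) / (2 ^ l * (Nat.factorial l : ℝ))) := by
  have h1 := natDegree_legendreDeriv_le l l
  rw [Nat.sub_self] at h1
  have h2 := eq_C_of_natDegree_le_zero h1
  have h3 := legendreDeriv_coeff_top (le_refl l)
  rw [Nat.sub_self, ← two_mul, Nat.descFactorial_self] at h3
  rw [h2, h3]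
  congr 1; ring

/-- The `k`-th derivatives of the Legendre polynomials span all polynomials. -/
theorem span_legendreDeriv (k : ℕ) :
    Submodule.span ℝ (range fun j : ℕ => legendreDeriv (j + k) k) = ⊤ := by
  let S : Polynomial.Sequence ℝ := ⟨fun j => legendreDeriv (j + k) k, fun j => by
    rw [degree_legendreDeriv (Nat.le_add_left k j), Nat.add_sub_cancel]⟩
  exact S.span fun i => isUnit_iff_ne_zero.2 (leadingCoeff_ne_zero.2 (S.ne_zero i))

end LegendreODE

/-! ### Orthogonality of the associated Legendre functions -/

/-- The weighted integral of `P_l^(k) P_j^(k)`, in the variable `x = cos θ`. -/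
def legendreInner (k l j : ℕ) : ℝ :=
  ∫ θ in (0 : ℝ)..Real.pi, Real.sin θ ^ (2 * k + 1) *
    ((legendreDeriv l k).eval (Real.cos θ) * (legendreDeriv j k).eval (Real.cos θ))

theorem hasDerivAt_legendreDeriv_cos (l k : ℕ) (θ : ℝ) :
    HasDerivAt (fun θ => (legendreDeriv l k).eval (Real.cos θ))
      (-(Real.sin θ * (legendreDeriv l (k + 1)).eval (Real.cos θ))) θ := by
  have := ((legendreDeriv l k).hasDerivAt (Real.cos θ)).comp θ (Real.hasDerivAt_cos θ)
  rw [derivative_legendreDeriv] at this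
  exact this.congr_deriv (by ring)

theorem legendreInner_succ (k l j : ℕ) :
    legendreInner (k + 1) l j = ((l : ℝ) + k + 1) * (l - k) * legendreInner k l j := by
  have hd : ∀ θ : ℝ, HasDerivAt (fun θ => Real.sin θ ^ (2 * k + 2) *
      ((legendreDeriv l (k + 1)).eval (Real.cos θ) * (legendreDeriv j k).eval (Real.cos θ)))
      (((l : ℝ) + k + 1) * (l - k) * (Real.sin θ ^ (2 * k + 1) *
        ((legendreDeriv l k).eval (Real.cos θ) * (legendreDeriv j k).eval (Real.cos θ))) -
      Real.sin θ ^ (2 * (k + 1) + 1) * ((legendreDeriv l (k + 1)).eval (Real.cos θ) *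
        (legendreDeriv j (k + 1)).eval (Real.cos θ))) θ := by
    intro θ
    refine (((Real.hasDerivAt_sin θ).pow (2 * k + 2)).mul
      ((hasDerivAt_legendreDeriv_cos l (k + 1) θ).mul
        (hasDerivAt_legendreDeriv_cos j k θ))).congr_deriv ?_
    have h := legendreDeriv_ode_eval l k (Real.cos θ)
    have hs : 1 - Real.cos θ ^ 2 = Real.sin θ ^ 2 := by
      linarith [Real.sin_sq_add_cos_sq θ]
    rw [hs] at h
    simp only [Pi.mul_apply, Pi.pow_apply]
    rw [show 2 * k + 2 - 1 = 2 * k + 1 by omega]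
    push_cast
    linear_combination (-(Real.sin θ) ^ (2 * k + 1) * (legendreDeriv j k).eval (Real.cos θ)) * h
  have hc : ∀ (k l j n : ℕ), Continuous fun θ : ℝ => Real.sin θ ^ n *
      ((legendreDeriv l k).eval (Real.cos θ) * (legendreDeriv j k).eval (Real.cos θ)) := by
    intro k l j n
    have h1 := (legendreDeriv l k).continuous.comp Real.continuous_cos
    have h2 := (legendreDeriv j k).continuous.comp Real.continuous_cos
    exact (Real.continuous_sin.pow n).mul (h1.mul h2)
  have h := intervalIntegral.integral_eq_sub_of_hasDerivAt (a := 0) (b := Real.pi)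
    (fun θ _ => hd θ) ((((hc k l j _).const_mul _).sub (hc (k + 1) l j _)).intervalIntegrable _ _)
  rw [intervalIntegral.integral_sub (((hc k l j _).const_mul _).intervalIntegrable _ _)
    ((hc (k + 1) l j _).intervalIntegrable _ _), intervalIntegral.integral_const_mul] at h
  simp only [Real.sin_pi, Real.sin_zero, ne_eq, Nat.add_eq_zero_iff, mul_eq_zero,
    OfNat.ofNat_ne_zero, and_false, not_false_eq_true, zero_pow, zero_mul, sub_self] at h
  rw [legendreInner, legendreInner]
  linarith

theorem legendreInner_comm (k l j : ℕ) : legendreInner k l j = legendreInner k j l := by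
  rw [legendreInner, legendreInner]
  simp only [mul_comm (Polynomial.eval _ (legendreDeriv l k))]

theorem legendreInner_of_ne (k : ℕ) {l j : ℕ} (h : l ≠ j) : legendreInner k l j = 0 := by
  induction k with
  | zero =>
    have h1 := legendreInner_succ 0 l j
    have h2 := legendreInner_succ 0 j l
    rw [legendreInner_comm 1 j l, legendreInner_comm 0 j l, h1] at h2
    have h3 : ((l : ℝ) - j) * ((l : ℝ) + j + 1) * legendreInner 0 l j = 0 := by
      push_cast at h2; linear_combination h2
    have h4 : (l : ℝ) - j ≠ 0 := sub_ne_zero.2 (by exact_mod_cast h)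
    have h5 : (l : ℝ) + j + 1 ≠ 0 := by positivity
    exact (mul_eq_zero.1 h3).resolve_left (mul_ne_zero h4 h5)
  | succ k ih => rw [legendreInner_succ, ih, mul_zero]

theorem legendreInner_self_mul (l k : ℕ) (hk : k ≤ l) :
    legendreInner k l l * ((l - k).factorial : ℝ) = (l + k).factorial * legendreInner 0 l l := by
  induction k with
  | zero => simp [mul_comm]
  | succ k ih =>
    have ih' := ih (by omega)
    have e : l - k = (l - (k + 1)) + 1 := by omega
    rw [e, Nat.factorial_succ, ← e] at ih'
    rw [legendreInner_succ, ← add_assoc, Nat.factorial_succ]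
    push_cast [Nat.cast_sub (show k ≤ l by omega)] at ih' ⊢
    linear_combination ((l : ℝ) + k + 1) * ih'

theorem prod_wallis (n : ℕ) : (2 * ∏ i ∈ Finset.range n, (2 * (i : ℝ) + 2) / (2 * i + 3)) *
    (2 * n + 1).factorial = 2 * (2 ^ n * n.factorial) ^ 2 := by
  induction n with
  | zero => simp
  | succ n ih =>
    rw [Finset.prod_range_succ, show 2 * (n + 1) + 1 = 2 * n + 1 + 1 + 1 by ring,
      Nat.factorial_succ (2 * n + 1 + 1), Nat.factorial_succ (2 * n + 1), Nat.factorial_succ n]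
    push_cast
    have : (2 * (n : ℝ) + 3) ≠ 0 := by positivity
    rw [show (2 : ℝ) * n + 1 + 1 + 1 = 2 * n + 3 by ring,
      show (2 * ((∏ i ∈ Finset.range n, (2 * (i : ℝ) + 2) / (2 * i + 3)) *
        ((2 * (n : ℝ) + 2) / (2 * n + 3)))) * ((2 * n + 3) *
          ((2 * n + 1 + 1) * ((2 * n + 1).factorial : ℝ))) =
        (2 * ∏ i ∈ Finset.range n, (2 * (i : ℝ) + 2) / (2 * i + 3)) * (2 * n + 1).factorial *
          (2 * n + 2) ^ 2 by field_simp; ring, ih]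
    ring

theorem legendreInner_zero_self (l : ℕ) : legendreInner 0 l l = 2 / (2 * l + 1) := by
  have h := legendreInner_self_mul l l le_rfl
  have h2 : legendreInner l l l = (((2 * l).factorial : ℝ) / (2 ^ l * (Nat.factorial l : ℝ))) ^ 2 *
      (2 * ∏ i ∈ Finset.range l, (2 * (i : ℝ) + 2) / (2 * i + 3)) := by
    rw [legendreInner, legendreDeriv_self]
    simp only [Polynomial.eval_C]
    rw [intervalIntegral.integral_mul_const, integral_sin_pow_odd]
    ring
  have h3 := prod_wallis l
  rw [Nat.sub_self, Nat.factorial_zero, Nat.cast_one, mul_one, ← two_mul, h2] at h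
  rw [Nat.factorial_succ] at h3
  push_cast at h3
  set W := 2 * ∏ i ∈ Finset.range l, (2 * (i : ℝ) + 2) / (2 * i + 3)
  have hf : ((2 * l).factorial : ℝ) ≠ 0 := by positivity
  have hg : (2 : ℝ) ^ l * l.factorial ≠ 0 := by positivity
  rw [eq_div_iff (by positivity)]
  set F := ((2 * l).factorial : ℝ)
  set G := (2 : ℝ) ^ l * l.factorial
  have h4 : F * (legendreInner 0 l l * (2 * l + 1)) = F * 2 := by
    calc F * (legendreInner 0 l l * (2 * l + 1))
        = (F / G) ^ 2 * W * (2 * l + 1) := by rw [h]; ring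
      _ = F / G ^ 2 * (W * ((2 * l + 1) * F)) := by ring
      _ = F / G ^ 2 * (2 * G ^ 2) := by rw [h3]
      _ = F * 2 := by field_simp
  exact mul_left_cancel₀ hf h4

theorem legendreInner_self {l k : ℕ} (hk : k ≤ l) :
    legendreInner k l l = 2 / (2 * l + 1) * ((l + k).factorial / (l - k).factorial) := by
  have h := legendreInner_self_mul l k hk
  have hf : ((l - k).factorial : ℝ) ≠ 0 := by positivity
  rw [legendreInner_zero_self] at h
  field_simp at h ⊢
  linarith

/-! ### The surface measure -/

theorem ae_mem_sphMeasure :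
    ∀ᵐ p ∂sphMeasure, p.1 ∈ Ioo 0 Real.pi ∧ p.2 ∈ Ico 0 (2 * Real.pi) := by
  have h1 : ∀ᵐ θ ∂((volume.restrict (Icc 0 Real.pi)).withDensity
      fun θ => ENNReal.ofReal (Real.sin θ)), θ ∈ Ioo 0 Real.pi := by
    refine (withDensity_absolutelyContinuous _ _).ae_le ?_
    rw [← restrict_Ioo_eq_restrict_Icc]
    exact ae_restrict_mem measurableSet_Ioo
  have h2 : ∀ᵐ φ ∂(volume.restrict (Ico 0 (2 * Real.pi)) : Measure ℝ), φ ∈ Ico 0 (2 * Real.pi) :=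
    ae_restrict_mem measurableSet_Ico
  exact (Measure.quasiMeasurePreserving_fst.ae h1).and (Measure.quasiMeasurePreserving_snd.ae h2)

theorem isFiniteMeasure_sin_density : IsFiniteMeasure
    ((volume.restrict (Icc 0 Real.pi)).withDensity fun θ => ENNReal.ofReal (Real.sin θ)) :=
  isFiniteMeasure_withDensity_ofReal
    (Real.continuous_sin.integrableOn_Icc (a := 0) (b := Real.pi)).hasFiniteIntegral

instance : IsFiniteMeasure sphMeasure := by
  have := isFiniteMeasure_sin_density
  rw [sphMeasure]
  infer_instance

theorem integral_sphMeasure_mul (f g : ℝ → ℂ) :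
    ∫ p, f p.1 * g p.2 ∂sphMeasure =
      (∫ θ in (0 : ℝ)..Real.pi, (Real.sin θ : ℂ) * f θ) * ∫ φ in (0 : ℝ)..2 * Real.pi, g φ := by
  have := isFiniteMeasure_sin_density
  rw [sphMeasure, integral_prod_mul, integral_Ico_eq_integral_Ioc,
    ← intervalIntegral.integral_of_le (by positivity)]
  congr 1
  rw [integral_withDensity_eq_integral_toReal_smul (by fun_prop) (by simp),
    intervalIntegral.integral_of_le Real.pi_pos.le, ← integral_Icc_eq_integral_Ioc]
  refine setIntegral_congr_fun measurableSet_Icc fun θ hθ => ?_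
  simp only [Complex.real_smul]
  rw [ENNReal.toReal_ofReal (Real.sin_nonneg_of_mem_Icc hθ)]

theorem continuous_sph : Continuous sph := by
  refine Continuous.subtype_mk ?_ _
  simp only [sphVec]
  refine (PiLp.continuous_toLp 2 _).comp (continuous_pi fun i => ?_)
  fin_cases i <;> simp <;> fun_prop

theorem memLp_comp_sph (g : C(S2, ℂ)) : MemLp (fun p => g (sph p)) 2 sphMeasure :=
  MemLp.of_bound (g.continuous.comp continuous_sph).aestronglyMeasurable ‖g‖
    (Eventually.of_forall fun p => g.norm_coe_le_norm (sph p))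

/-! ### Spherical harmonics -/

/-- The constant of proportionality between `Y_{lm}` and
`e^{imφ} (sin θ)^{|m|} P_l^{(|m|)}(cos θ)`. -/
def harmonicScale (l : ℕ) (m : ℤ) : ℝ :=
  harmonicConst l m * if 0 ≤ m then (-1) ^ m.natAbs
    else ((l - m.natAbs).factorial : ℝ) / ((l + m.natAbs).factorial : ℝ)

/-- The dependence of `Y_{lm}` on `θ`. -/
def harmonicTheta (l : ℕ) (m : ℤ) (θ : ℝ) : ℝ :=
  harmonicScale l m * (Real.sin θ ^ m.natAbs * (legendreDeriv l m.natAbs).eval (Real.cos θ))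

theorem sphHarmonic_eq (l : ℕ) (m : ℤ) {p : ℝ × ℝ} (hp : p.1 ∈ Icc 0 Real.pi) :
    sphHarmonic l m p =
      (harmonicTheta l m p.1 : ℂ) * Complex.exp (Complex.I * (m : ℂ) * (p.2 : ℂ)) := by
  have hs : Real.sqrt (1 - Real.cos p.1 ^ 2) = Real.sin p.1 := by
    rw [← Real.sin_sq, Real.sqrt_sq (Real.sin_nonneg_of_mem_Icc hp)]
  have h1 : ((-1 : ℝ) ^ m.natAbs) * (-1) ^ m.natAbs = 1 := by
    rw [← mul_pow]; norm_num
  have : harmonicConst l m * assocLegendre l m (Real.cos p.1) = harmonicTheta l m p.1 := by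
    rw [assocLegendre, harmonicTheta, harmonicScale]
    split_ifs with hm
    · have : m.toNat = m.natAbs := by omega
      rw [this, assocLegendreNat, hs, legendreDeriv]
      ring
    · rw [assocLegendreNat, hs, legendreDeriv]
      linear_combination (harmonicConst l m * ((l - m.natAbs).factorial : ℝ) /
        ((l + m.natAbs).factorial : ℝ) * Real.sin p.1 ^ m.natAbs *
        (Polynomial.derivative^[m.natAbs] (legendre l)).eval (Real.cos p.1)) * h1
  rw [sphHarmonic, ← this]
  push_cast
  ring

theorem harmonicScale_sq {l : ℕ} {m : ℤ} (hm : m.natAbs ≤ l) :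
    harmonicScale l m ^ 2 = (2 * (l : ℝ) + 1) / (4 * Real.pi) *
      (((l - m.natAbs).factorial : ℝ) / ((l + m.natAbs).factorial : ℝ)) := by
  have h1 : (((-1 : ℝ) ^ m.natAbs)) ^ 2 = 1 := by
    rw [← pow_mul, mul_comm, pow_mul]; norm_num
  have ha : ((l - m.natAbs).factorial : ℝ) ≠ 0 := by positivity
  have hb : ((l + m.natAbs).factorial : ℝ) ≠ 0 := by positivity
  rw [harmonicScale, harmonicConst, mul_pow, mul_pow, h1, one_mul, Real.sq_sqrt (by positivity)]
  split_ifs with h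
  · have e1 : ((l : ℤ) - m).toNat = l - m.natAbs := by omega
    have e2 : ((l : ℤ) + m).toNat = l + m.natAbs := by omega
    rw [e1, e2, h1, mul_one]
  · have e1 : ((l : ℤ) - m).toNat = l + m.natAbs := by omega
    have e2 : ((l : ℤ) + m).toNat = l - m.natAbs := by omega
    rw [e1, e2]
    field_simp

theorem integral_exp_int_mul (n : ℤ) :
    ∫ φ in (0 : ℝ)..2 * Real.pi, Complex.exp (Complex.I * (n : ℂ) * (φ : ℂ)) =
      if n = 0 then 2 * (Real.pi : ℂ) else 0 := by
  split_ifs with h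
  · simp [h]
  · have hn : Complex.I * (n : ℂ) ≠ 0 := mul_ne_zero Complex.I_ne_zero (by exact_mod_cast h)
    rw [integral_exp_mul_complex hn]
    have : Complex.I * (n : ℂ) * ((2 * Real.pi : ℝ) : ℂ) = n * (2 * Real.pi * Complex.I) := by
      push_cast; ring
    rw [this, Complex.exp_int_mul_two_pi_mul_I]
    simp

theorem integral_sphHarmonic_mul_conj {l j : ℕ} {m n : ℤ} (hm : m.natAbs ≤ l) :
    ∫ p, sphHarmonic l m p * conj (sphHarmonic j n p) ∂sphMeasure =
      if l = j ∧ m = n then 1 else 0 := by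
  have h1 : ∫ p, sphHarmonic l m p * conj (sphHarmonic j n p) ∂sphMeasure =
      ∫ p, ((harmonicTheta l m p.1 * harmonicTheta j n p.1 : ℝ) : ℂ) *
        Complex.exp (Complex.I * ((m - n : ℤ) : ℂ) * (p.2 : ℂ)) ∂sphMeasure := by
    refine integral_congr_ae ?_
    filter_upwards [ae_mem_sphMeasure] with p hp
    rw [sphHarmonic_eq l m (Ioo_subset_Icc_self hp.1),
      sphHarmonic_eq j n (Ioo_subset_Icc_self hp.1),
      map_mul, Complex.conj_ofReal, ← Complex.exp_conj, map_mul, map_mul, Complex.conj_I,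
      Complex.conj_ofReal, map_intCast]
    have : Complex.I * ((m - n : ℤ) : ℂ) * (p.2 : ℂ) =
        Complex.I * (m : ℂ) * (p.2 : ℂ) + -Complex.I * (n : ℂ) * (p.2 : ℂ) := by push_cast; ring
    rw [this, Complex.exp_add]
    push_cast
    ring
  rw [h1, integral_sphMeasure_mul
    (fun θ => ((harmonicTheta l m θ * harmonicTheta j n θ : ℝ) : ℂ))
    (fun φ => Complex.exp (Complex.I * ((m - n : ℤ) : ℂ) * (φ : ℂ))), integral_exp_int_mul]
  by_cases hmn : m = n
  · subst hmn
    have h2 : ∫ θ in (0 : ℝ)..Real.pi, (Real.sin θ : ℂ) *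
        ((harmonicTheta l m θ * harmonicTheta j m θ : ℝ) : ℂ) =
        ((harmonicScale l m * harmonicScale j m * legendreInner m.natAbs l j : ℝ) : ℂ) := by
      rw [legendreInner, ← intervalIntegral.integral_const_mul, ← intervalIntegral.integral_ofReal]
      refine intervalIntegral.integral_congr fun θ _ => ?_
      simp only [harmonicTheta]
      push_cast
      ring
    rw [h2, sub_self, if_pos rfl]
    by_cases hlj : l = j
    · subst hlj
      rw [if_pos ⟨rfl, rfl⟩, legendreInner_self hm, ← pow_two, harmonicScale_sq hm]
      have ha : ((l - m.natAbs).factorial : ℝ) ≠ 0 := by positivity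
      have hb : ((l + m.natAbs).factorial : ℝ) ≠ 0 := by positivity
      have hc : (2 * (l : ℝ) + 1) ≠ 0 := by positivity
      have hpi := Real.pi_ne_zero
      have : ((2 * (l : ℝ) + 1) / (4 * Real.pi) *
          (((l - m.natAbs).factorial : ℝ) / ((l + m.natAbs).factorial : ℝ)) *
          (2 / (2 * l + 1) * ((l + m.natAbs).factorial / (l - m.natAbs).factorial))) *
          (2 * Real.pi) = 1 := by
        field_simp
        norm_num
      exact_mod_cast this
    · rw [if_neg (fun h => hlj h.1), legendreInner_of_ne _ hlj]
      simp
  · rw [if_neg (fun h => hmn (sub_eq_zero.1 h)), if_neg (fun h => hmn h.2), mul_zero]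

/-- The polynomial function on `ℝ³` that restricts to `Y_{lm}`. -/
def harmonicPoly (l : ℕ) (m : ℤ) (x : E3) : ℂ :=
  (harmonicScale l m : ℂ) *
    ((x 1 : ℂ) + (if 0 ≤ m then 1 else -1) * Complex.I * (x 2 : ℂ)) ^ m.natAbs *
    ((legendreDeriv l m.natAbs).eval (x 0) : ℝ)

theorem contDiff_harmonicPoly (l : ℕ) (m : ℤ) {n : WithTop ℕ∞} :
    ContDiff ℝ n (harmonicPoly l m) := by
  have hx : ∀ i : Fin 3, ContDiff ℝ n fun x : E3 => x i := fun i => by fun_prop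
  have hxc : ∀ i : Fin 3, ContDiff ℝ n fun x : E3 => (x i : ℂ) := fun i =>
    Complex.ofRealCLM.contDiff.comp (hx i)
  have hp0 : ContDiff ℝ n fun x : ℝ => (legendreDeriv l m.natAbs).eval x := by
    simpa using (legendreDeriv l m.natAbs).contDiff_aeval (𝕜 := ℝ) n
  have hp : ContDiff ℝ n fun x : E3 => (((legendreDeriv l m.natAbs).eval (x 0) : ℝ) : ℂ) :=
    Complex.ofRealCLM.contDiff.comp (hp0.comp (hx 0))
  exact (contDiff_const.mul (((hxc 1).add (contDiff_const.mul (hxc 2))).pow _)).mul hp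

theorem exp_int_mul_eq (m : ℤ) (φ : ℝ) : Complex.exp (Complex.I * (m : ℂ) * (φ : ℂ)) =
    ((Real.cos φ : ℂ) + (if 0 ≤ m then 1 else -1) * Complex.I * (Real.sin φ : ℂ)) ^ m.natAbs := by
  split_ifs with h
  · have : (m : ℂ) = (m.natAbs : ℂ) := by
      have : m = (m.natAbs : ℤ) := by omega
      conv_lhs => rw [this]
      rfl
    rw [this, show Complex.I * (m.natAbs : ℂ) * (φ : ℂ) =
      (m.natAbs : ℂ) * ((φ : ℂ) * Complex.I) by ring,
      Complex.exp_nat_mul, Complex.exp_mul_I]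
    push_cast
    ring
  · have : (m : ℂ) = -(m.natAbs : ℂ) := by
      have : m = -(m.natAbs : ℤ) := by omega
      conv_lhs => rw [this]
      rw [Int.cast_neg, Int.cast_natCast]
    rw [this, show Complex.I * -(m.natAbs : ℂ) * (φ : ℂ) =
      (m.natAbs : ℂ) * (((-φ : ℝ) : ℂ) * Complex.I) by push_cast; ring,
      Complex.exp_nat_mul, Complex.exp_mul_I]
    push_cast
    rw [Complex.cos_neg, Complex.sin_neg]
    ring

theorem harmonicPoly_sph (l : ℕ) (m : ℤ) (p : ℝ × ℝ) :
    harmonicPoly l m (sph p) =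
      (harmonicTheta l m p.1 : ℂ) * Complex.exp (Complex.I * (m : ℂ) * (p.2 : ℂ)) := by
  have h0 : (sph p : E3) 0 = Real.cos p.1 := rfl
  have h1 : (sph p : E3) 1 = Real.sin p.1 * Real.cos p.2 := rfl
  have h2 : (sph p : E3) 2 = Real.sin p.1 * Real.sin p.2 := rfl
  rw [harmonicPoly, h0, h1, h2, exp_int_mul_eq, harmonicTheta]
  push_cast
  rw [show (Complex.sin p.1 * Complex.cos p.2 + (if 0 ≤ m then 1 else -1) * Complex.I *
    (Complex.sin p.1 * Complex.sin p.2)) = Complex.sin p.1 * (Complex.cos p.2 +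
      (if 0 ≤ m then 1 else -1) * Complex.I * Complex.sin p.2) by ring, mul_pow]
  ring

theorem sphHarmonic_ae_eq (l : ℕ) (m : ℤ) :
    ∀ᵐ p ∂sphMeasure, sphHarmonic l m p = harmonicPoly l m (sph p) := by
  filter_upwards [ae_mem_sphMeasure] with p hp
  rw [sphHarmonic_eq l m (Ioo_subset_Icc_self hp.1), harmonicPoly_sph]

theorem memLp_sphHarmonic (l : ℕ) (m : ℤ) : MemLp (sphHarmonic l m) 2 sphMeasure := by
  have h := memLp_comp_sph ⟨fun x => harmonicPoly l m x,
    (contDiff_harmonicPoly l m (n := 0)).continuous.comp continuous_subtype_val⟩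
  exact (memLp_congr_ae (sphHarmonic_ae_eq l m)).2 h

/-! ### Spherical harmonics are eigenfunctions of the Laplacian -/

theorem natCast_mul_pow_sub_one_mul {R : Type*} [CommRing R] (k : ℕ) (s : R) :
    (k : R) * s ^ (k - 1) * s = k * s ^ k := by
  rcases k with _ | k
  · simp
  · rw [Nat.add_sub_cancel, pow_succ]; ring

theorem laplaceBeltrami_harmonicTheta_mul (l : ℕ) (m : ℤ) {Φ Φ' : ℝ → ℝ}
    (hΦ : ∀ φ, HasDerivAt Φ (Φ' φ) φ) (hΦ' : ∀ φ, HasDerivAt Φ' (-((m : ℝ) ^ 2 * Φ φ)) φ)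
    {p : ℝ × ℝ} (hp : Real.sin p.1 ≠ 0) :
    laplaceBeltrami (fun p => harmonicTheta l m p.1 * Φ p.2) p =
      -((l : ℝ) * (l + 1)) * (harmonicTheta l m p.1 * Φ p.2) := by
  obtain ⟨θ, φ⟩ := p
  simp only at hp
  set k := m.natAbs with hk
  have hmk : (m : ℝ) ^ 2 = (k : ℝ) ^ 2 := by
    rw [hk, Nat.cast_natAbs, Int.cast_abs, sq_abs]
  set Q : ℕ → ℝ → ℝ := fun j θ => (legendreDeriv l j).eval (Real.cos θ) with hQ
  have hQd : ∀ j θ, HasDerivAt (Q j) (-(Real.sin θ * Q (j + 1) θ)) θ := fun j θ =>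
    hasDerivAt_legendreDeriv_cos l j θ
  have hS : ∀ (j : ℕ) (θ : ℝ), HasDerivAt (fun θ => Real.sin θ ^ j)
      (j * Real.sin θ ^ (j - 1) * Real.cos θ) θ :=
    fun j θ => (Real.hasDerivAt_sin θ).pow j
  set κ := harmonicScale l m
  set T' : ℝ → ℝ := fun θ => κ * (k * Real.sin θ ^ (k - 1) * Real.cos θ * Q k θ -
    Real.sin θ ^ (k + 1) * Q (k + 1) θ) with hT'
  have hT : ∀ θ, HasDerivAt (harmonicTheta l m) (T' θ) θ := by
    intro θ
    refine (((hS k θ).mul (hQd k θ)).const_mul κ).congr_deriv ?_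
    simp only [hT']
    ring
  have hTT : HasDerivAt T' (κ * ((k * ((k - 1 : ℕ) * Real.sin θ ^ (k - 1 - 1) * Real.cos θ) *
      Real.cos θ - k * Real.sin θ ^ (k - 1) * Real.sin θ) * Q k θ -
      k * Real.sin θ ^ (k - 1) * Real.cos θ * (Real.sin θ * Q (k + 1) θ) -
      (((k : ℝ) + 1) * Real.sin θ ^ k * Real.cos θ * Q (k + 1) θ -
        Real.sin θ ^ (k + 1) * (Real.sin θ * Q (k + 2) θ)))) θ := by
    refine ((((((hS (k - 1) θ).const_mul (k : ℝ)).mul (Real.hasDerivAt_cos θ)).mul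
      (hQd k θ)).sub ((hS (k + 1) θ).mul (hQd (k + 1) θ))).const_mul κ).congr_deriv ?_
    simp only [Nat.add_sub_cancel, Pi.mul_apply]
    push_cast
    ring
  have e1 : deriv (fun θ => harmonicTheta l m θ * Φ φ) = fun θ => T' θ * Φ φ :=
    funext fun θ => ((hT θ).mul_const _).deriv
  have e2 : deriv (fun φ => harmonicTheta l m θ * Φ φ) = fun φ => harmonicTheta l m θ * Φ' φ :=
    funext fun φ => ((hΦ φ).const_mul _).deriv
  have hode := legendreDeriv_ode_eval l k (Real.cos θ)
  rw [← Real.sin_sq] at hode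
  rw [laplaceBeltrami]
  simp only [iteratedDeriv_succ, iteratedDeriv_zero]
  rw [e1, e2, (hTT.mul_const _).deriv, ((hΦ' φ).const_mul _).deriv, hmk]
  have p1 := natCast_mul_pow_sub_one_mul k (Real.sin θ)
  have p2 : (k : ℝ) * ((k - 1 : ℕ) * Real.sin θ ^ (k - 1 - 1)) * Real.sin θ ^ 2 =
      k * (k - 1) * Real.sin θ ^ k := by
    have q := natCast_mul_pow_sub_one_mul (k - 1) (Real.sin θ)
    rcases Nat.eq_zero_or_pos k with h0 | h0
    · simp [h0]
    · have hc : ((k - 1 : ℕ) : ℝ) = k - 1 := by rw [Nat.cast_sub h0]; simp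
      rw [hc] at q ⊢
      linear_combination (k : ℝ) * Real.sin θ * q + ((k : ℝ) - 1) * p1
  have hsq : Real.cos θ ^ 2 = 1 - Real.sin θ ^ 2 := Real.cos_sq' θ
  have hs2 : Real.sin θ ^ 2 ≠ 0 := pow_ne_zero 2 hp
  have hΘ : harmonicTheta l m θ = κ * (Real.sin θ ^ k * Q k θ) := rfl
  rw [hΘ]
  simp only [hT']
  change Real.sin θ ^ 2 * Q (k + 2) θ = 2 * (k + 1) * Real.cos θ * Q (k + 1) θ -
    ((l : ℝ) + k + 1) * (l - k) * Q k θ at hode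
  generalize Q k θ = A at *
  generalize Q (k + 1) θ = B at *
  generalize Q (k + 2) θ = D at *
  generalize Real.sin θ ^ (k - 1 - 1) = s2 at *
  generalize Real.sin θ ^ (k - 1) = s1 at *
  rw [pow_succ]
  generalize Real.sin θ ^ k = s0 at *
  generalize Real.cos θ = x at *
  generalize Real.sin θ = s at *
  generalize Φ φ = F at *
  have hinv : s * s⁻¹ = 1 := mul_inv_cancel₀ hp
  have hinv2 : s ^ 2 * (s ^ 2)⁻¹ = 1 := mul_inv_cancel₀ hs2
  refine mul_left_cancel₀ hs2 ?_
  linear_combination (κ * F * x ^ 2 * A) * p2 +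
    (κ * F * (-s ^ 2 * A - s ^ 2 * x * B + x ^ 2 * A)) * p1 +
    (κ * F * s0 * s ^ 2) * hode + (κ * F * s0 * A * (k : ℝ) ^ 2) * hsq +
    (s * x * F * κ * (k * s1 * x * A - s0 * s * B)) * hinv -
    ((k : ℝ) ^ 2 * κ * s0 * A * F) * hinv2

theorem re_harmonicPoly_sph (l : ℕ) (m : ℤ) (p : ℝ × ℝ) : (harmonicPoly l m (sph p)).re =
    harmonicTheta l m p.1 * Real.cos (m * p.2) := by
  have : Complex.I * (m : ℂ) * (p.2 : ℂ) = ((m * p.2 : ℝ) : ℂ) * Complex.I := by push_cast; ring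
  rw [harmonicPoly_sph, this, Complex.re_ofReal_mul, Complex.exp_ofReal_mul_I_re]

theorem im_harmonicPoly_sph (l : ℕ) (m : ℤ) (p : ℝ × ℝ) : (harmonicPoly l m (sph p)).im =
    harmonicTheta l m p.1 * Real.sin (m * p.2) := by
  have : Complex.I * (m : ℂ) * (p.2 : ℂ) = ((m * p.2 : ℝ) : ℂ) * Complex.I := by push_cast; ring
  rw [harmonicPoly_sph, this, Complex.im_ofReal_mul, Complex.exp_ofReal_mul_I_im]

theorem laplaceBeltrami_re_harmonicPoly (l : ℕ) (m : ℤ) {p : ℝ × ℝ} (hp : Real.sin p.1 ≠ 0) :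
    laplaceBeltrami (fun p => (harmonicPoly l m (sph p)).re) p =
      -((l : ℝ) * (l + 1)) * (harmonicPoly l m (sph p)).re := by
  simp only [re_harmonicPoly_sph]
  have hlin : ∀ φ : ℝ, HasDerivAt (fun φ : ℝ => (m : ℝ) * φ) m φ := fun φ => by
    simpa using (hasDerivAt_id φ).const_mul (m : ℝ)
  exact laplaceBeltrami_harmonicTheta_mul l m (Φ := fun φ => Real.cos (m * φ))
    (Φ' := fun φ => -Real.sin (m * φ) * m) (fun φ => (hlin φ).cos)
    (fun φ => ((hlin φ).sin.neg.mul_const _).congr_deriv (by ring)) hp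

theorem laplaceBeltrami_im_harmonicPoly (l : ℕ) (m : ℤ) {p : ℝ × ℝ} (hp : Real.sin p.1 ≠ 0) :
    laplaceBeltrami (fun p => (harmonicPoly l m (sph p)).im) p =
      -((l : ℝ) * (l + 1)) * (harmonicPoly l m (sph p)).im := by
  simp only [im_harmonicPoly_sph]
  have hlin : ∀ φ : ℝ, HasDerivAt (fun φ : ℝ => (m : ℝ) * φ) m φ := fun φ => by
    simpa using (hasDerivAt_id φ).const_mul (m : ℝ)
  exact laplaceBeltrami_harmonicTheta_mul l m (Φ := fun φ => Real.sin (m * φ))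
    (Φ' := fun φ => Real.cos (m * φ) * m) (fun φ => (hlin φ).sin)
    (fun φ => ((hlin φ).cos.mul_const _).congr_deriv (by ring)) hp

/-! ### Density of the spherical harmonics in the continuous functions -/

theorem sq_add_sq_add_sq_of_mem_sphere (x : S2) :
    (x : E3) 0 ^ 2 + (x : E3) 1 ^ 2 + (x : E3) 2 ^ 2 = 1 := by
  have h := x.2
  rw [mem_sphere_zero_iff_norm] at h
  have h2 := EuclideanSpace.real_norm_sq_eq (x : E3)
  rw [h, Fin.sum_univ_three] at h2
  linarith

theorem continuous_sphere_apply (i : Fin 3) : Continuous fun x : S2 => (x : E3) i :=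
  (by fun_prop : Continuous fun x : E3 => x i).comp continuous_subtype_val

/-- The coordinate `x₀` on the sphere. -/
def coordZero : C(S2, ℂ) :=
  ⟨fun x => ((x : E3) 0 : ℂ), Complex.continuous_ofReal.comp (continuous_sphere_apply 0)⟩

/-- The complex coordinate `x₁ + i x₂` on the sphere. -/
def coordPlane : C(S2, ℂ) :=
  ⟨fun x => ((x : E3) 1 : ℂ) + Complex.I * ((x : E3) 2 : ℂ),
    (Complex.continuous_ofReal.comp (continuous_sphere_apply 1)).add
      (continuous_const.mul (Complex.continuous_ofReal.comp (continuous_sphere_apply 2)))⟩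

/-- The function `(x₁ ± i x₂)^{|m|} Q(x₀)` on the sphere, where `±` is the sign of `m`. -/
def planePoly (m : ℤ) (Q : Polynomial ℝ) : C(S2, ℂ) :=
  ⟨fun x => (((x : E3) 1 : ℂ) + (if 0 ≤ m then 1 else -1) * Complex.I * ((x : E3) 2 : ℂ)) ^
      m.natAbs * (Q.eval ((x : E3) 0) : ℝ),
    (((Complex.continuous_ofReal.comp (continuous_sphere_apply 1)).add
      (continuous_const.mul (Complex.continuous_ofReal.comp (continuous_sphere_apply 2)))).pow
        _).mul
      (Complex.continuous_ofReal.comp (Q.continuous.comp (continuous_sphere_apply 0)))⟩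

/-- The spherical harmonic `Y_{lm}` as a continuous function on the sphere. -/
def harmonicMap (l : ℕ) (m : ℤ) : C(S2, ℂ) :=
  (harmonicScale l m : ℂ) • planePoly m (legendreDeriv l m.natAbs)

theorem harmonicMap_apply (l : ℕ) (m : ℤ) (x : S2) : harmonicMap l m x = harmonicPoly l m x := by
  simp only [harmonicMap, harmonicPoly, planePoly, ContinuousMap.smul_apply, ContinuousMap.coe_mk,
    smul_eq_mul, mul_assoc]

theorem harmonicScale_ne_zero {l : ℕ} {m : ℤ} (hm : m.natAbs ≤ l) : harmonicScale l m ≠ 0 := by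
  intro h
  have h2 := harmonicScale_sq hm
  rw [h] at h2
  have : 0 < (2 * (l : ℝ) + 1) / (4 * Real.pi) *
      (((l - m.natAbs).factorial : ℝ) / ((l + m.natAbs).factorial : ℝ)) := by positivity
  rw [← h2] at this
  norm_num at this

theorem planePoly_mem {N : Submodule ℂ C(S2, ℂ)}
    (hN : ∀ (l : ℕ) (m : ℤ), m.natAbs ≤ l → harmonicMap l m ∈ N) (m : ℤ) (Q : Polynomial ℝ) :
    planePoly m Q ∈ N := by
  have hQ : Q ∈ Submodule.span ℝ (range fun j : ℕ => legendreDeriv (j + m.natAbs) m.natAbs) := by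
    rw [span_legendreDeriv]; trivial
  induction hQ using Submodule.span_induction with
  | mem Q h =>
    obtain ⟨j, rfl⟩ := h
    have h1 := hN (j + m.natAbs) m (by omega)
    have h2 : (harmonicScale (j + m.natAbs) m : ℂ) ≠ 0 :=
      Complex.ofReal_ne_zero.2 (harmonicScale_ne_zero (by omega))
    exact (N.smul_mem_iff h2).1 h1
  | zero =>
    convert! N.zero_mem
    ext x
    simp [planePoly]
  | add P Q _ _ hP hQ =>
    convert! N.add_mem hP hQ
    ext x
    simp [planePoly, mul_add]
  | smul a Q _ hQ =>
    convert! N.smul_mem (a : ℂ) hQ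
    ext x
    simp [planePoly]
    ring

theorem monomial_eq_planePoly (a b c : ℕ) :
    ∃ (m : ℤ) (Q : Polynomial ℝ),
      coordZero ^ a * coordPlane ^ b * star coordPlane ^ c = planePoly m Q := by
  have hrel : ∀ x : S2, (((x : E3) 1 : ℂ) + Complex.I * ((x : E3) 2 : ℂ)) *
      (((x : E3) 1 : ℂ) - Complex.I * ((x : E3) 2 : ℂ)) = 1 - ((x : E3) 0 : ℂ) ^ 2 := by
    intro x
    have h : (((x : E3) 0 : ℂ)) ^ 2 + ((x : E3) 1 : ℂ) ^ 2 + ((x : E3) 2 : ℂ) ^ 2 = 1 := by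
      have h := congrArg Complex.ofReal (sq_add_sq_add_sq_of_mem_sphere x)
      push_cast at h
      exact h
    linear_combination h - ((x : E3) 2 : ℂ) ^ 2 * Complex.I_sq
  have hstar : ∀ x : S2, (star coordPlane) x =
      ((x : E3) 1 : ℂ) - Complex.I * ((x : E3) 2 : ℂ) := by
    intro x
    simp [coordPlane, sub_eq_add_neg]
  have hzero : ∀ x : S2, coordZero x = ((x : E3) 0 : ℂ) := fun _ => rfl
  have hplane : ∀ x : S2, coordPlane x = ((x : E3) 1 : ℂ) + Complex.I * ((x : E3) 2 : ℂ) :=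
    fun _ => rfl
  rcases le_total c b with h | h
  · obtain ⟨d, rfl⟩ := Nat.exists_eq_add_of_le h
    refine ⟨d, Polynomial.X ^ a * (1 - Polynomial.X ^ 2) ^ c, ?_⟩
    ext x
    simp only [ContinuousMap.mul_apply, ContinuousMap.pow_apply, hstar, planePoly,
      ContinuousMap.coe_mk, Int.natAbs_natCast, Int.natCast_nonneg, if_true, one_mul,
      Polynomial.eval_mul, Polynomial.eval_pow, Polynomial.eval_X, Polynomial.eval_sub,
      Polynomial.eval_one, hzero, hplane]
    push_cast
    rw [← hrel x, mul_pow]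
    ring
  · obtain ⟨d, rfl⟩ := Nat.exists_eq_add_of_le h
    rcases Nat.eq_zero_or_pos d with rfl | hd
    · refine ⟨0, Polynomial.X ^ a * (1 - Polynomial.X ^ 2) ^ b, ?_⟩
      ext x
      simp only [ContinuousMap.mul_apply, ContinuousMap.pow_apply, hstar, planePoly,
        ContinuousMap.coe_mk, Int.natAbs_zero, le_refl, if_true, one_mul, pow_zero, add_zero,
        Polynomial.eval_mul, Polynomial.eval_pow, Polynomial.eval_X, Polynomial.eval_sub,
        Polynomial.eval_one, hzero, hplane]
      push_cast
      rw [← hrel x, mul_pow]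
      ring
    · refine ⟨-d, Polynomial.X ^ a * (1 - Polynomial.X ^ 2) ^ b, ?_⟩
      have hneg : ¬ (0 : ℤ) ≤ -d := by omega
      ext x
      simp only [ContinuousMap.mul_apply, ContinuousMap.pow_apply, hstar, planePoly,
        ContinuousMap.coe_mk, Int.natAbs_neg, Int.natAbs_natCast, if_neg hneg,
        Polynomial.eval_mul, Polynomial.eval_pow, Polynomial.eval_X, Polynomial.eval_sub,
        Polynomial.eval_one, hzero, hplane]
      push_cast
      rw [← hrel x, mul_pow, neg_one_mul, neg_mul, ← sub_eq_add_neg]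
      ring

/-- A closed subspace of `C(𝕊²)` that contains the spherical harmonics is everything. -/
theorem eq_top_of_harmonicMap_mem {N : Submodule ℂ C(S2, ℂ)} (hclosed : IsClosed (N : Set C(S2, ℂ)))
    (hN : ∀ (l : ℕ) (m : ℤ), m.natAbs ≤ l → harmonicMap l m ∈ N) : N = ⊤ := by
  set A := StarAlgebra.adjoin ℂ ({coordZero, coordPlane} : Set C(S2, ℂ)) with hA
  have hsub : Subalgebra.toSubmodule A.toSubalgebra ≤ N := by
    rw [hA, StarAlgebra.adjoin_eq_span, Submodule.span_le]
    intro g hg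
    have hmon : ∃ a b c : ℕ, g = coordZero ^ a * coordPlane ^ b * star coordPlane ^ c := by
      induction hg using Submonoid.closure_induction with
      | mem g hg =>
        have hreal : star coordZero = coordZero := by
          ext x; simp [coordZero]
        rcases hg with (rfl | rfl) | hg
        · exact ⟨1, 0, 0, by simp⟩
        · exact ⟨0, 1, 0, by simp⟩
        · rcases Set.mem_star.1 hg with h | h
          · have : g = coordZero := by rw [← star_star g, h, hreal]
            exact ⟨1, 0, 0, by simp [this]⟩
          · have : g = star coordPlane := by
              rw [← star_star g]; exact congrArg star h
            exact ⟨0, 0, 1, by simp [this]⟩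
      | one => exact ⟨0, 0, 0, by simp⟩
      | mul g h _ _ ihg ihh =>
        obtain ⟨a, b, c, rfl⟩ := ihg
        obtain ⟨a', b', c', rfl⟩ := ihh
        exact ⟨a + a', b + b', c + c', by ring⟩
    obtain ⟨a, b, c, rfl⟩ := hmon
    obtain ⟨m, Q, h⟩ := monomial_eq_planePoly a b c
    rw [h]
    exact planePoly_mem hN m Q
  have hsep : A.SeparatesPoints := by
    intro x y hxy
    by_contra! hcon
    have h0 := hcon coordZero ⟨coordZero, StarAlgebra.subset_adjoin ℂ _ (by simp), rfl⟩
    have h1 := hcon coordPlane ⟨coordPlane, StarAlgebra.subset_adjoin ℂ _ (by simp), rfl⟩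
    apply hxy
    ext i
    simp only [coordZero, coordPlane, ContinuousMap.coe_mk, Complex.ofReal_inj] at h0 h1
    have h2 := congrArg Complex.re h1
    have h3 := congrArg Complex.im h1
    simp at h2 h3
    fin_cases i
    · exact h0
    · exact h2
    · exact h3
  have htop := ContinuousMap.starSubalgebra_topologicalClosure_eq_top_of_separatesPoints A hsep
  rw [eq_top_iff]
  intro g _
  have hg : g ∈ A.topologicalClosure := by rw [htop]; trivial
  rw [← SetLike.mem_coe, StarSubalgebra.topologicalClosure_coe] at hg
  exact closure_minimal (fun h hh => hsub hh) hclosed hg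

/-! ### Completeness of the spherical harmonics in `L²` -/

/-- The spherical harmonic `Y_{lm}` as an element of `L²`. -/
def harmonicLp (l : ℕ) (m : ℤ) : Lp ℂ 2 sphMeasure := (memLp_sphHarmonic l m).toLp _

theorem injOn_sph : InjOn sph (Ioo 0 Real.pi ×ˢ Ico 0 (2 * Real.pi)) := by
  rintro ⟨θ, φ⟩ h ⟨θ', φ'⟩ h' heq
  have hv : sphVec θ φ = sphVec θ' φ' := congrArg Subtype.val heq
  have h0 : Real.cos θ = Real.cos θ' := congrFun (congrArg WithLp.ofLp hv) 0
  have h1 : Real.sin θ * Real.cos φ = Real.sin θ' * Real.cos φ' :=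
    congrFun (congrArg WithLp.ofLp hv) 1
  have h2 : Real.sin θ * Real.sin φ = Real.sin θ' * Real.sin φ' :=
    congrFun (congrArg WithLp.ofLp hv) 2
  have hθ : θ = θ' := Real.injOn_cos (Ioo_subset_Icc_self h.1) (Ioo_subset_Icc_self h'.1) h0
  subst hθ
  have hs : Real.sin θ ≠ 0 := (Real.sin_pos_of_mem_Ioo h.1).ne'
  have hc := mul_left_cancel₀ hs h1
  have hs' := mul_left_cancel₀ hs h2
  have hφ : (φ : Real.Angle) = φ' := Real.Angle.cos_sin_inj hc hs'
  obtain ⟨k, hk⟩ := Real.Angle.angle_eq_iff_two_pi_dvd_sub.1 hφ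
  have hφ1 := h.2
  have hφ2 := h'.2
  simp only [mem_Ico] at hφ1 hφ2
  have hpi := Real.pi_pos
  have hk0 : k = 0 := by
    have a1 : (k : ℝ) < 1 := by
      by_contra! hcon
      nlinarith
    have a2 : (-1 : ℝ) < k := by
      by_contra! hcon
      nlinarith
    have b1 : k < 1 := by exact_mod_cast a1
    have b2 : -1 < k := by exact_mod_cast a2
    omega
  rw [hk0] at hk
  simp only [Int.cast_zero, mul_zero] at hk
  rw [sub_eq_zero.1 hk]

theorem measurePreserving_sph : MeasurePreserving sph sphMeasure (sphMeasure.map sph) :=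
  ⟨continuous_sph.measurable, rfl⟩

/-- Composition of continuous functions on the sphere with the spherical coordinates. -/
def sphPullback : C(S2, ℂ) →L[ℂ] Lp ℂ 2 sphMeasure :=
  haveI : IsFiniteMeasure (sphMeasure.map sph) := Measure.isFiniteMeasure_map _ _
  (Lp.compMeasurePreservingₗᵢ ℂ sph measurePreserving_sph).toContinuousLinearMap ∘L
    ContinuousMap.toLp 2 (sphMeasure.map sph) ℂ

theorem sphPullback_harmonicMap (l : ℕ) (m : ℤ) :
    sphPullback (harmonicMap l m) = harmonicLp l m := by
  have : IsFiniteMeasure (sphMeasure.map sph) := Measure.isFiniteMeasure_map _ _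
  apply Lp.ext
  have h1 := Lp.coeFn_compMeasurePreserving
    (ContinuousMap.toLp (E := ℂ) 2 (sphMeasure.map sph) ℂ (harmonicMap l m)) measurePreserving_sph
  have h2 := measurePreserving_sph.quasiMeasurePreserving.ae
    (ContinuousMap.coeFn_toLp (p := 2) (𝕜 := ℂ) (sphMeasure.map sph) (harmonicMap l m))
  have h3 := (memLp_sphHarmonic l m).coeFn_toLp
  filter_upwards [h1, h2, h3, sphHarmonic_ae_eq l m] with p h1 h2 h3 h4
  rw [harmonicLp, h3, h4, ← harmonicMap_apply, ← h2]
  exact h1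

theorem eq_zero_of_inner_sphPullback {F : Lp ℂ 2 sphMeasure}
    (hF : ∀ g, inner ℂ (sphPullback g) F = 0) : F = 0 := by
  have : IsFiniteMeasure (sphMeasure.map sph) := Measure.isFiniteMeasure_map _ _
  have hall : ∀ h : Lp ℂ 2 (sphMeasure.map sph),
      inner ℂ (Lp.compMeasurePreservingₗᵢ ℂ sph measurePreserving_sph h) F = 0 := by
    have hdense := ContinuousMap.toLp_denseRange ℂ (sphMeasure.map sph) ℂ
      (p := 2) (by norm_num)
    have hcont : Continuous fun h : Lp ℂ 2 (sphMeasure.map sph) =>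
        inner ℂ (Lp.compMeasurePreservingₗᵢ ℂ sph measurePreserving_sph h) F :=
      (LinearIsometry.continuous _).inner continuous_const
    have := hdense.equalizer hcont (continuous_const (y := (0 : ℂ))) (funext fun g => hF g)
    exact fun h => congrFun this h
  have hint : Integrable F sphMeasure := (Lp.memLp F).integrable (by norm_num)
  apply (Lp.eq_zero_iff_ae_eq_zero).2
  refine hint.ae_eq_zero_of_forall_setIntegral_eq_zero fun B hB _ => ?_
  set R : Set (ℝ × ℝ) := Ioo 0 Real.pi ×ˢ Ico 0 (2 * Real.pi) with hR
  have hBR : MeasurableSet (B ∩ R) := hB.inter (measurableSet_Ioo.prod measurableSet_Ico)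
  have hB' : MeasurableSet (sph '' (B ∩ R)) :=
    hBR.image_of_continuousOn_injOn continuous_sph.continuousOn
      (injOn_sph.mono inter_subset_right)
  have hae : (sph ⁻¹' (sph '' (B ∩ R)) : Set (ℝ × ℝ)) =ᵐ[sphMeasure] B := by
    filter_upwards [ae_mem_sphMeasure] with p hp
    refine propext ⟨?_, fun hpB => ⟨p, ⟨hpB, hp⟩, rfl⟩⟩
    rintro ⟨q, hq, hqp⟩
    have := injOn_sph hq.2 (show p ∈ R from hp) hqp
    exact this ▸ hq.1
  rw [← setIntegral_congr_set hae]
  have h := hall (indicatorConstLp 2 hB' (measure_ne_top _ _) (1 : ℂ))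
  have h2 : Lp.compMeasurePreservingₗᵢ ℂ sph measurePreserving_sph
      (indicatorConstLp 2 hB' (measure_ne_top _ _) (1 : ℂ)) =
      indicatorConstLp 2 (hB'.preimage continuous_sph.measurable) (measure_ne_top _ _) (1 : ℂ) :=
    Lp.indicatorConstLp_compMeasurePreserving hB' _ _ measurePreserving_sph
  rw [h2, L2.inner_indicatorConstLp_one] at h
  exact h

/-- A square integrable function orthogonal to the spherical harmonics vanishes. -/
theorem eq_zero_of_inner_harmonicLp {F : Lp ℂ 2 sphMeasure}
    (hF : ∀ (l : ℕ) (m : ℤ), m.natAbs ≤ l → inner ℂ (harmonicLp l m) F = 0) : F = 0 := by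
  set Λ : C(S2, ℂ) →L[ℂ] ℂ := (innerSL ℂ F) ∘L sphPullback with hΛ
  have hker : LinearMap.ker (Λ : C(S2, ℂ) →ₗ[ℂ] ℂ) = ⊤ := by
    refine eq_top_of_harmonicMap_mem Λ.isClosed_ker fun l m hm => ?_
    rw [LinearMap.mem_ker]
    change inner ℂ F (sphPullback (harmonicMap l m)) = 0
    rw [sphPullback_harmonicMap, ← inner_conj_symm, hF l m hm, map_zero]
  refine eq_zero_of_inner_sphPullback fun g => ?_
  have hg : g ∈ LinearMap.ker (Λ : C(S2, ℂ) →ₗ[ℂ] ℂ) := by rw [hker]; trivial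
  have hg' : inner ℂ F (sphPullback g) = 0 := hg
  rw [← inner_conj_symm, hg', map_zero]

/-! ### Parseval's identity for spherical harmonics -/

theorem hilbertBasis_hasSum_norm_sub_sq {ι E : Type*} [NormedAddCommGroup E]
    [InnerProductSpace ℂ E] [DecidableEq ι] (b : HilbertBasis ι ℂ E) (x : E) (s : Finset ι) :
    HasSum (fun i => if i ∈ s then 0 else ‖inner ℂ (b i) x‖ ^ 2)
      (‖x - ∑ i ∈ s, inner ℂ (b i) x • b i‖ ^ 2) := by
  set y := x - ∑ i ∈ s, inner ℂ (b i) x • b i with hy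
  have hcoord : ∀ i, inner ℂ (b i) y = if i ∈ s then 0 else inner ℂ (b i) x := by
    intro i
    rw [hy, inner_sub_right, inner_sum]
    simp only [inner_smul_right, (orthonormal_iff_ite.1 b.orthonormal), mul_ite, mul_one, mul_zero,
      Finset.sum_ite_eq]
    split_ifs <;> simp
  have h := lp.hasSum_norm (p := 2) (by norm_num) (b.repr y)
  rw [LinearIsometryEquiv.norm_map] at h
  simp only [b.repr_apply_apply, hcoord, ENNReal.toReal_ofNat, Real.rpow_ofNat] at h
  convert! h using 2 with i
  split_ifs <;> simp

theorem natAbs_le_of_mem_Icc {l : ℕ} {m : ℤ} (hm : m ∈ Finset.Icc (-(l : ℤ)) l) : m.natAbs ≤ l := by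
  have := Finset.mem_Icc.1 hm
  omega

/-- The spherical harmonics as a Hilbert basis of `L²` of the sphere. -/
theorem exists_hilbertBasis_harmonicLp :
    ∃ b : HilbertBasis (Σ l : ℕ, Finset.Icc (-(l : ℤ)) (l : ℤ)) ℂ (Lp ℂ 2 sphMeasure),
      ∀ i, b i = harmonicLp i.1 i.2 := by
  have hinner : ∀ (l j : ℕ) (m n : ℤ), inner ℂ (harmonicLp j n) (harmonicLp l m) =
      ∫ p, sphHarmonic l m p * conj (sphHarmonic j n p) ∂sphMeasure := by
    intro l j m n
    rw [L2.inner_def]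
    refine integral_congr_ae ?_
    filter_upwards [(memLp_sphHarmonic l m).coeFn_toLp, (memLp_sphHarmonic j n).coeFn_toLp]
      with p h1 h2
    rw [harmonicLp, harmonicLp, h1, h2, RCLike.inner_apply]
  have horth : Orthonormal ℂ fun i : Σ l : ℕ, Finset.Icc (-(l : ℤ)) (l : ℤ) =>
      harmonicLp i.1 i.2 := by
    rw [orthonormal_iff_ite]
    rintro ⟨j, n, hn⟩ ⟨l, m, hm⟩
    simp only
    rw [hinner, integral_sphHarmonic_mul_conj (natAbs_le_of_mem_Icc hm)]
    by_cases h : l = j ∧ m = n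
    · obtain ⟨rfl, rfl⟩ := h
      simp
    · rw [if_neg h, if_neg]
      intro heq
      rw [Sigma.mk.injEq] at heq
      obtain ⟨rfl, h2⟩ := heq
      exact h ⟨rfl, (congrArg Subtype.val (eq_of_heq h2)).symm⟩
  have hbot : (Submodule.span ℂ (range fun i : Σ l : ℕ, Finset.Icc (-(l : ℤ)) (l : ℤ) =>
      harmonicLp i.1 i.2))ᗮ = ⊥ := by
    rw [Submodule.eq_bot_iff]
    intro F hF
    refine eq_zero_of_inner_harmonicLp fun l m hm => ?_
    exact (Submodule.mem_orthogonal _ _).1 hF _ (Submodule.subset_span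
      ⟨⟨l, m, Finset.mem_Icc.2 (by omega)⟩, rfl⟩)
  exact ⟨HilbertBasis.mkOfOrthogonalEqBot horth hbot, fun i => by
    rw [HilbertBasis.coe_mkOfOrthogonalEqBot]⟩

/-- The coefficient of a function on the sphere with respect to `Y_{lm}`. -/
def harmonicCoeff (v : ℝ × ℝ → ℂ) (l : ℕ) (m : ℤ) : ℂ :=
  ∫ p, v p * conj (sphHarmonic l m p) ∂sphMeasure

theorem inner_harmonicLp_toLp {v : ℝ × ℝ → ℂ} (hv : MemLp v 2 sphMeasure) (l : ℕ) (m : ℤ) :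
    inner ℂ (harmonicLp l m) (hv.toLp v) = harmonicCoeff v l m := by
  rw [L2.inner_def, harmonicCoeff]
  refine integral_congr_ae ?_
  filter_upwards [(memLp_sphHarmonic l m).coeFn_toLp, hv.coeFn_toLp] with p h1 h2
  rw [harmonicLp, h1, h2, RCLike.inner_apply]

theorem eLpNorm_two_sq {α E : Type*} [MeasurableSpace α] [NormedAddCommGroup E] (μ : Measure α)
    (f : α → E) : eLpNorm f 2 μ ^ 2 = ∫⁻ x, ‖f x‖ₑ ^ 2 ∂μ := by
  have := eLpNorm_nnreal_pow_eq_lintegral (μ := μ) (f := f) (p := 2) two_ne_zero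
  simpa using this

theorem eLpNorm_sub_harmonic_sum_sq {v : ℝ × ℝ → ℂ} (hv : MemLp v 2 sphMeasure) (L : ℕ) :
    eLpNorm (fun p => v p - ∑ l ∈ Finset.range (L + 1), ∑ m ∈ Finset.Icc (-(l : ℤ)) (l : ℤ),
      harmonicCoeff v l m * sphHarmonic l m p) 2 sphMeasure ^ 2 =
    ∑' l : ℕ, if l ∈ Finset.range (L + 1) then 0
      else ∑ m ∈ Finset.Icc (-(l : ℤ)) (l : ℤ), ‖harmonicCoeff v l m‖ₑ ^ 2 := by
  classical
  obtain ⟨b, hb⟩ := exists_hilbertBasis_harmonicLp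
  set s : Finset (Σ l : ℕ, Finset.Icc (-(l : ℤ)) (l : ℤ)) :=
    (Finset.range (L + 1)).sigma fun _ => Finset.univ with hs
  have h := hilbertBasis_hasSum_norm_sub_sq b (hv.toLp v) s
  simp only [hb, inner_harmonicLp_toLp] at h
  have hsum : MemLp (fun p => ∑ l ∈ Finset.range (L + 1), ∑ m ∈ Finset.Icc (-(l : ℤ)) (l : ℤ),
      harmonicCoeff v l m * sphHarmonic l m p) 2 sphMeasure :=
    memLp_finsetSum _ fun l _ => memLp_finsetSum _ fun m _ => (memLp_sphHarmonic l m).const_mul _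
  have hae : hv.toLp v - ∑ i ∈ s, harmonicCoeff v i.1 i.2 • harmonicLp i.1 i.2 =
      (hv.sub hsum).toLp _ := by
    rw [MemLp.toLp_sub hv hsum]
    congr 1
    apply Lp.ext
    refine (Lp.coeFn_finsetSum _ _).trans (EventuallyEq.trans ?_ hsum.coeFn_toLp.symm)
    have hall : ∀ᵐ p ∂sphMeasure, ∀ i : Σ l : ℕ, Finset.Icc (-(l : ℤ)) (l : ℤ),
        (harmonicCoeff v i.1 i.2 • harmonicLp i.1 i.2 : Lp ℂ 2 sphMeasure) p =
          harmonicCoeff v i.1 i.2 * sphHarmonic i.1 i.2 p := by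
      rw [ae_all_iff]
      intro i
      filter_upwards [Lp.coeFn_smul (harmonicCoeff v i.1 i.2) (harmonicLp i.1 i.2),
        (memLp_sphHarmonic i.1 i.2).coeFn_toLp] with p h1 h2
      rw [h1, Pi.smul_apply, harmonicLp, h2, smul_eq_mul]
    filter_upwards [hall] with p hp
    simp only [Finset.sum_apply, hp]
    rw [hs, Finset.sum_sigma]
    refine Finset.sum_congr rfl fun l _ => ?_
    exact Finset.sum_coe_sort (Finset.Icc (-(l : ℤ)) (l : ℤ))
      fun m => harmonicCoeff v l m * sphHarmonic l m p
  rw [hae] at h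
  have h2 := ENNReal.ofReal_tsum_of_nonneg (fun i => by positivity) h.summable
  rw [h.tsum_eq, ENNReal.ofReal_pow (norm_nonneg _), ofReal_norm, Lp.enorm_toLp] at h2
  refine h2.trans ?_
  have hterm : ∀ i : Σ l : ℕ, Finset.Icc (-(l : ℤ)) (l : ℤ),
      ENNReal.ofReal (if i ∈ s then 0 else ‖harmonicCoeff v i.1 i.2‖ ^ 2) =
        if i.1 ∈ Finset.range (L + 1) then 0 else ‖harmonicCoeff v i.1 i.2‖ₑ ^ 2 := by
    intro i
    have hi : i ∈ s ↔ i.1 ∈ Finset.range (L + 1) := by simp [hs]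
    simp only [hi]
    split_ifs
    · simp
    · rw [ENNReal.ofReal_pow (norm_nonneg _), ofReal_norm]
  rw [tsum_congr hterm]
  refine (ENNReal.tsum_sigma fun (l : ℕ) (m : Finset.Icc (-(l : ℤ)) (l : ℤ)) =>
    if l ∈ Finset.range (L + 1) then 0 else ‖harmonicCoeff v l m‖ₑ ^ 2).trans ?_
  refine tsum_congr fun l => ?_
  split_ifs
  · simp
  · exact Finset.tsum_subtype (Finset.Icc (-(l : ℤ)) (l : ℤ))
      fun m => ‖harmonicCoeff v l m‖ₑ ^ 2

theorem enorm_harmonicLp {l : ℕ} {m : ℤ} (hm : m ∈ Finset.Icc (-(l : ℤ)) (l : ℤ)) :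
    ‖harmonicLp l m‖ₑ = 1 := by
  obtain ⟨b, hb⟩ := exists_hilbertBasis_harmonicLp
  rw [← hb ⟨l, m, hm⟩, ← ofReal_norm, b.orthonormal.norm_eq_one, ENNReal.ofReal_one]

theorem enorm_harmonicCoeff_le {v : ℝ × ℝ → ℂ} (hv : MemLp v 2 sphMeasure) {l : ℕ} {m : ℤ}
    (hm : m ∈ Finset.Icc (-(l : ℤ)) (l : ℤ)) :
    ‖harmonicCoeff v l m‖ₑ ≤ eLpNorm v 2 sphMeasure := by
  rw [← inner_harmonicLp_toLp hv, ← Lp.enorm_toLp hv, ← one_mul ‖hv.toLp v‖ₑ,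
    ← enorm_harmonicLp hm, ← ofReal_norm, ← ofReal_norm, ← ofReal_norm,
    ← ENNReal.ofReal_mul (norm_nonneg _)]
  exact ENNReal.ofReal_le_ofReal (norm_inner_le_norm _ _)

/-- The coefficients of a real function, through the real and imaginary parts of `Y_{lm}`. -/
theorem harmonicCoeff_ofReal {w : ℝ × ℝ → ℝ} (hw : MemLp w 2 sphMeasure) (l : ℕ) (m : ℤ) :
    harmonicCoeff (fun p => (w p : ℂ)) l m =
      ((∫ p, w p * (harmonicPoly l m (sph p)).re ∂sphMeasure : ℝ) : ℂ) -
        Complex.I * ((∫ p, w p * (harmonicPoly l m (sph p)).im ∂sphMeasure : ℝ) : ℂ) := by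
  have hY : MemLp (fun p => harmonicPoly l m (sph p)) 2 sphMeasure :=
    (memLp_congr_ae (sphHarmonic_ae_eq l m)).1 (memLp_sphHarmonic l m)
  have h1 : Integrable (fun p => w p * (harmonicPoly l m (sph p)).re) sphMeasure :=
    hw.integrable_mul hY.re
  have h2 : Integrable (fun p => w p * (harmonicPoly l m (sph p)).im) sphMeasure :=
    hw.integrable_mul hY.im
  rw [← integral_complex_ofReal, ← integral_complex_ofReal, ← integral_const_mul,
    ← integral_sub h1.ofReal (h2.ofReal.const_mul _), harmonicCoeff]
  refine integral_congr_ae ?_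
  filter_upwards [sphHarmonic_ae_eq l m] with p hp
  rw [hp]
  conv_lhs => rw [← Complex.re_add_im (harmonicPoly l m (sph p))]
  simp only [map_add, map_mul, Complex.conj_ofReal, Complex.conj_I]
  push_cast
  ring

/-! ### The coefficients of the solution -/

section Solution

variable {Ω : Type*} [MeasurableSpace Ω] {P : Measure Ω}
  {T : S2 → Ω → ℝ} {u : ℝ → S2 → Ω → ℝ} {c D r ηinf : ℝ}

theorem IsIsotropicGaussianField.ae_memLp [SFinite P] (hT : IsIsotropicGaussianField P T) :
    ∀ᵐ ω ∂P, MemLp (fun p => T (sph p) ω) 2 sphMeasure := by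
  have h1 := hT.memLp.1.prodMk_left
  have h2 := ((memLp_two_iff_integrable_sq_norm hT.memLp.1).1 hT.memLp).prod_right_ae
  filter_upwards [h1, h2] with ω h1 h2
  exact (memLp_two_iff_integrable_sq_norm h1).2 h2

/-- Tested against an eigenfunction of the Laplacian, a solution follows the time factor. -/
theorem IsSolution.ae_integral_eq (hu : IsSolution c D r ηinf P T u) (hc : 0 < c) (hD : 0 < D)
    (hr : 0 < r) (hη : 0 < ηinf) (l : ℕ) {g : E3 → ℝ}
    (hg : ContDiff ℝ ((⊤ : ℕ∞) : WithTop ℕ∞) g)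
    (heig : ∀ p : ℝ × ℝ, Real.sin p.1 ≠ 0 →
      laplaceBeltrami (fun p => g (sph p)) p = -((l : ℝ) * (l + 1)) * g (sph p)) :
    ∀ᵐ ω ∂P, ∀ η ∈ Ico 0 ηinf, ∫ p, u η (sph p) ω * g (sph p) ∂sphMeasure =
      (∫ p, T (sph p) ω * g (sph p) ∂sphMeasure) * timeFactor c D r ηinf l η := by
  filter_upwards [hu.equation g hg] with ω hω η hmem
  obtain ⟨hU, hode, h0, h0'⟩ := hω
  rw [← h0]
  refine eq_mul_timeFactor_of_ode hc hD hr hη l hU (fun η hη' => ?_) h0' hmem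
  rw [← hode η hη']
  congr 2
  rw [← integral_const_mul]
  refine integral_congr_ae ?_
  filter_upwards [ae_mem_sphMeasure] with p hp
  rw [heig p (Real.sin_pos_of_mem_Ioo hp.1).ne']
  ring

theorem IsSolution.ae_harmonicCoeff_eq [SFinite P] (hu : IsSolution c D r ηinf P T u)
    (hT : IsIsotropicGaussianField P T) (hc : 0 < c) (hD : 0 < D) (hr : 0 < r) (hη : 0 < ηinf) :
    ∀ᵐ ω ∂P, ∀ (l : ℕ) (m : ℤ), ∀ η ∈ Ico 0 ηinf,
      harmonicCoeff (fun p => (u η (sph p) ω : ℂ)) l m =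
        (timeFactor c D r ηinf l η : ℂ) * coeff T l m ω := by
  have h1 : ∀ᵐ ω ∂P, ∀ (l : ℕ) (m : ℤ), ∀ η ∈ Ico 0 ηinf,
      ∫ p, u η (sph p) ω * (harmonicPoly l m (sph p)).re ∂sphMeasure =
        (∫ p, T (sph p) ω * (harmonicPoly l m (sph p)).re ∂sphMeasure) *
          timeFactor c D r ηinf l η := by
    simp only [ae_all_iff]
    exact fun l m => hu.ae_integral_eq hc hD hr hη l
      (Complex.reCLM.contDiff.comp (contDiff_harmonicPoly l m))
      fun p hp => laplaceBeltrami_re_harmonicPoly l m hp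
  have h2 : ∀ᵐ ω ∂P, ∀ (l : ℕ) (m : ℤ), ∀ η ∈ Ico 0 ηinf,
      ∫ p, u η (sph p) ω * (harmonicPoly l m (sph p)).im ∂sphMeasure =
        (∫ p, T (sph p) ω * (harmonicPoly l m (sph p)).im ∂sphMeasure) *
          timeFactor c D r ηinf l η := by
    simp only [ae_all_iff]
    exact fun l m => hu.ae_integral_eq hc hD hr hη l
      (Complex.imCLM.contDiff.comp (contDiff_harmonicPoly l m))
      fun p hp => laplaceBeltrami_im_harmonicPoly l m hp
  filter_upwards [h1, h2, hu.memLp, hT.ae_memLp] with ω h1 h2 hmu hmT l m η hmem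
  have hcoeff : coeff T l m ω = harmonicCoeff (fun p => (T (sph p) ω : ℂ)) l m := rfl
  rw [hcoeff, harmonicCoeff_ofReal (hmu η hmem), harmonicCoeff_ofReal hmT, h1 l m η hmem,
    h2 l m η hmem]
  push_cast
  ring

theorem aestronglyMeasurable_coeff (hT : IsIsotropicGaussianField P T) (l : ℕ) (m : ℤ) :
    AEStronglyMeasurable (coeff T l m) P := by
  have h1 : AEStronglyMeasurable (fun q : Ω × (ℝ × ℝ) => (T (sph q.2) q.1 : ℂ))
      (P.prod sphMeasure) := Complex.continuous_ofReal.comp_aestronglyMeasurable hT.memLp.1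
  have h2 : AEStronglyMeasurable (fun q : Ω × (ℝ × ℝ) => conj (sphHarmonic l m q.2))
      (P.prod sphMeasure) :=
    Complex.continuous_conj.comp_aestronglyMeasurable (memLp_sphHarmonic l m).1.comp_snd
  exact (h1.mul h2).integral_prod_right'

theorem lintegral_enorm_coeff_sq [SFinite P] (hT : IsIsotropicGaussianField P T) {l : ℕ} {m : ℤ}
    (hm : m ∈ Finset.Icc (-(l : ℤ)) (l : ℤ)) :
    ∫⁻ ω, ‖coeff T l m ω‖ₑ ^ 2 ∂P = ENNReal.ofReal (∫ ω, ‖coeff T l m ω‖ ^ 2 ∂P) := by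
  have hmeas := aestronglyMeasurable_coeff hT l m
  have hle : ∫⁻ ω, ‖coeff T l m ω‖ₑ ^ 2 ∂P ≤
      eLpNorm (fun q : Ω × (ℝ × ℝ) => T (sph q.2) q.1) 2 (P.prod sphMeasure) ^ 2 := by
    rw [eLpNorm_two_sq, lintegral_prod _ (hT.memLp.1.enorm.pow_const 2)]
    refine lintegral_mono_ae ?_
    filter_upwards [hT.ae_memLp] with ω hω
    have h := enorm_harmonicCoeff_le (v := fun p => (T (sph p) ω : ℂ)) hω.ofReal hm
    calc ‖coeff T l m ω‖ₑ ^ 2 ≤ eLpNorm (fun p => (T (sph p) ω : ℂ)) 2 sphMeasure ^ 2 := by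
          gcongr
          exact h
      _ = _ := by
          rw [eLpNorm_two_sq]
          refine lintegral_congr fun p => ?_
          rw [← ofReal_norm, Complex.norm_real, ofReal_norm]
  have hmem : MemLp (coeff T l m) 2 P := by
    refine ⟨hmeas, ?_⟩
    have hlt := hle.trans_lt (ENNReal.pow_lt_top hT.memLp.2)
    rw [← eLpNorm_two_sq] at hlt
    exact (ENNReal.pow_lt_top_iff.1 hlt).resolve_right two_ne_zero
  rw [ofReal_integral_eq_lintegral_ofReal ((memLp_two_iff_integrable_sq_norm hmeas).1 hmem)
    (Eventually.of_forall fun ω => by positivity)]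
  refine lintegral_congr fun ω => ?_
  rw [ENNReal.ofReal_pow (norm_nonneg _), ofReal_norm]

theorem sum_lintegral_enorm_coeff_sq [SFinite P] (hT : IsIsotropicGaussianField P T) (l : ℕ) :
    ∑ m ∈ Finset.Icc (-(l : ℤ)) (l : ℤ), ∫⁻ ω, ‖coeff T l m ω‖ₑ ^ 2 ∂P =
      ENNReal.ofReal (angularPower P T l * (2 * (l : ℝ) + 1)) := by
  have hl : (2 * (l : ℝ) + 1) ≠ 0 := by positivity
  rw [angularPower, div_mul_cancel₀ _ hl, ENNReal.ofReal_sum_of_nonneg fun m _ =>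
    integral_nonneg fun ω => by positivity]
  exact Finset.sum_congr rfl fun m hm => lintegral_enorm_coeff_sq hT hm

theorem angularPower_nonneg (l : ℕ) : 0 ≤ angularPower P T l :=
  div_nonneg (Finset.sum_nonneg fun m _ => integral_nonneg fun ω => by positivity) (by positivity)

theorem aestronglyMeasurable_truncation (hT : IsIsotropicGaussianField P T) (L : ℕ) (η : ℝ) :
    AEStronglyMeasurable (fun q : Ω × (ℝ × ℝ) => truncation c D r ηinf T L η q.2 q.1)
      (P.prod sphMeasure) := by
  unfold truncation
  refine Finset.aestronglyMeasurable_fun_sum _ fun l _ => ?_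
  refine AEStronglyMeasurable.const_mul ?_ _
  refine Finset.aestronglyMeasurable_fun_sum _ fun m _ => ?_
  exact (aestronglyMeasurable_coeff hT l m).comp_fst.mul (memLp_sphHarmonic l m).1.comp_snd

theorem IsSolution.eLpNorm_sub_truncation_sq_le [SFinite P] (hu : IsSolution c D r ηinf P T u)
    (hT : IsIsotropicGaussianField P T) (hc : 0 < c) (hD : 0 < D) (hr : 0 < r) (hη : 0 < ηinf)
    (L : ℕ) {η : ℝ} (hmem : η ∈ Ico 0 ηinf) :
    eLpNorm (fun q : Ω × (ℝ × ℝ) =>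
      (u η (sph q.2) q.1 : ℂ) - truncation c D r ηinf T L η q.2 q.1) 2 (P.prod sphMeasure) ^ 2 ≤
    ∑' l : ℕ, if l ∈ Finset.range (L + 1) then 0
      else ENNReal.ofReal (angularPower P T l * (2 * (l : ℝ) + 1)) := by
  have hmeas : AEStronglyMeasurable (fun q : Ω × (ℝ × ℝ) =>
      (u η (sph q.2) q.1 : ℂ) - truncation c D r ηinf T L η q.2 q.1) (P.prod sphMeasure) :=
    (Complex.continuous_ofReal.comp_aestronglyMeasurable (hu.measurable η hmem)).sub
      (aestronglyMeasurable_truncation hT L η)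
  have hcm : ∀ (l : ℕ) (m : ℤ), AEMeasurable (fun ω => ‖coeff T l m ω‖ₑ ^ 2) P := fun l m =>
    (aestronglyMeasurable_coeff hT l m).enorm.pow_const 2
  rw [eLpNorm_two_sq, lintegral_prod _ (hmeas.enorm.pow_const 2)]
  calc ∫⁻ ω, ∫⁻ p, ‖(u η (sph p) ω : ℂ) - truncation c D r ηinf T L η p ω‖ₑ ^ 2 ∂sphMeasure ∂P
      ≤ ∫⁻ ω, ∑' l : ℕ, (if l ∈ Finset.range (L + 1) then 0
          else ∑ m ∈ Finset.Icc (-(l : ℤ)) (l : ℤ), ‖coeff T l m ω‖ₑ ^ 2) ∂P := by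
        refine lintegral_mono_ae ?_
        filter_upwards [hu.memLp, hu.ae_harmonicCoeff_eq hT hc hD hr hη] with ω hω hcoef
        have hv : MemLp (fun p => (u η (sph p) ω : ℂ)) 2 sphMeasure := (hω η hmem).ofReal
        have htr : ∀ p, truncation c D r ηinf T L η p ω =
            ∑ l ∈ Finset.range (L + 1), ∑ m ∈ Finset.Icc (-(l : ℤ)) (l : ℤ),
              harmonicCoeff (fun p => (u η (sph p) ω : ℂ)) l m * sphHarmonic l m p := by
          intro p
          rw [truncation]
          refine Finset.sum_congr rfl fun l _ => ?_
          rw [Finset.mul_sum]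
          refine Finset.sum_congr rfl fun m _ => ?_
          rw [hcoef l m η hmem, mul_assoc]
        have hpars := eLpNorm_sub_harmonic_sum_sq hv L
        simp only [htr]
        rw [← eLpNorm_two_sq, hpars]
        refine ENNReal.tsum_le_tsum fun l => ?_
        split_ifs
        · exact le_rfl
        · refine Finset.sum_le_sum fun m _ => ?_
          gcongr
          rw [hcoef l m η hmem, enorm_mul]
          refine mul_le_of_le_one_left zero_le ?_
          rw [← ofReal_norm, Complex.norm_real, Real.norm_eq_abs]
          exact ENNReal.ofReal_le_one.2 (abs_timeFactor_le_one hc hD hr hη l hmem)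
    _ = ∑' l : ℕ, if l ∈ Finset.range (L + 1) then 0
          else ENNReal.ofReal (angularPower P T l * (2 * (l : ℝ) + 1)) := by
        rw [lintegral_tsum]
        · refine tsum_congr fun l => ?_
          split_ifs
          · simp
          · rw [lintegral_finsetSum' _ fun m _ => hcm l m, sum_lintegral_enorm_coeff_sq hT]
        · intro l
          split_ifs
          · exact aemeasurable_const
          · exact Finset.aemeasurable_fun_sum _ fun m _ => hcm l m

end Solution

end SphDiff

end

open SphDiff
theorem theorem3 (c D r ηinf : ℝ) (hc : 0 < c) (hD : 0 < D) (hr : 0 < r) (hη : 0 < ηinf) :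
    ∃ C : ℝ, 0 < C ∧
      ∀ (Ω : Type*) [MeasurableSpace Ω] (P : Measure Ω) [IsProbabilityMeasure P]
        (T : S2 → Ω → ℝ) (u : ℝ → S2 → Ω → ℝ),
        IsIsotropicGaussianField P T →
        Summable (fun l : ℕ => angularPower P T l * (2 * (l : ℝ) + 1)) →
        IsSolution c D r ηinf P T u →
        ∀ (L : ℕ), ∀ η ∈ Ico 0 ηinf,
          eLpNorm (fun q : Ω × (ℝ × ℝ) =>
              (u η (sph q.2) q.1 : ℂ) - truncation c D r ηinf T L η q.2 q.1)
            2 (P.prod sphMeasure)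
          ≤ ENNReal.ofReal
              (C * Real.sqrt (∑' l : Ioi L, angularPower P T l * (2 * ((l : ℕ) : ℝ) + 1))) := by
  refine ⟨1, one_pos, fun Ω _ P _ T u hT hsum hu L η hmem => ?_⟩
  have hnn : ∀ l : ℕ, 0 ≤ angularPower P T l * (2 * (l : ℝ) + 1) := fun l =>
    mul_nonneg (angularPower_nonneg l) (by positivity)
  have hnn' : ∀ l : Ioi L, 0 ≤ angularPower P T l * (2 * ((l : ℕ) : ℝ) + 1) := fun l => hnn l
  have htail : (∑' l : ℕ, if l ∈ Finset.range (L + 1) then 0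
      else ENNReal.ofReal (angularPower P T l * (2 * (l : ℝ) + 1))) =
      ENNReal.ofReal (∑' l : Ioi L, angularPower P T l * (2 * ((l : ℕ) : ℝ) + 1)) := by
    rw [ENNReal.ofReal_tsum_of_nonneg hnn' (hsum.comp_injective Subtype.val_injective),
      tsum_subtype (Ioi L) fun l : ℕ =>
        ENNReal.ofReal (angularPower P T l * (2 * (l : ℝ) + 1))]
    refine tsum_congr fun l => ?_
    by_cases h : L < l
    · rw [if_neg (by simpa using h), indicator_of_mem (show l ∈ Ioi L from h)]
    · rw [if_pos (by simpa using Nat.lt_succ_of_le (not_lt.1 h)),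
        indicator_of_notMem (show l ∉ Ioi L from h)]
  rw [one_mul, ← ENNReal.pow_le_pow_left_iff two_ne_zero, ← ENNReal.ofReal_pow (Real.sqrt_nonneg _),
    Real.sq_sqrt (tsum_nonneg hnn'), ← htail]
  exact hu.eLpNorm_sub_truncation_sq_le hT hc hD hr hη L hmem
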